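/- Let $X$ be a set. A \emph{big interval} is a linear order with at least two points that is dense (whenever $x<y$ there is $z$ with $x<z<y$), order-complete (every non-empty subset with an upper bound has a supremum) and has a minimum and a maximum, equipped with its order topology. A \emph{big circle} is a topological space obtained by identifying the minimum and the maximum of a big interval, with the quotient topology. Let $\mathrm{BCir}(X)$ be the set of topologies $\tau$ on $X$ such that $(X,\tau)$ is a big circle (up to homeomorphism). For $\mathcal C\subseteq\mathcal P(X)$, $Y\subseteq X$ and $y\in Y$ let $C_{\ni y}(Y):=\bigcup\{Z\in\mathcal C : y\in Z\subseteq Y\}$. A \emph{connectivity} on $X$ is a set $\mathcal C\subseteq\mathcal P(X)$ such that: (C1) $\{x\}\in\mathcal C$ for all $x\in X$; (C2) if $C\subseteq\mathcal C$ and $\bigcap C\ne\emptyset$, then $\bigcup C\in\mathcal C$ (where $\bigcap\emptyset = X$); (C3) for all $Y\in\mathcal C$ and $x,y\in Y$ we have $Y\setminus C_{\ni y}(Y\setminus\{x\})\in\mathcal C$; (C4) for all non-empty $A,B\in\mathcal C$ with $A\cup B\in\mathcal C$, either there is $x\in A\cup B$ with $A\cup\{x\}\in\mathcal C$ and $B\cup\{x\}\in\mathcal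 C$, or there is $S\in\mathcal C$ with $S\subseteq A\cup B$ such that $S\cap A\notin\mathcal C$ or $S\cap B\notin\mathcal C$. The sets $C_{\ni y}(Y)$ with $y \in Y$ are then the \emph{$\mathcal C$-components} of $Y$. The connectivity is \emph{$2$-flimsy} if $|X|>2$ and, for $S\subseteq X$, $X\setminus S\in\mathcal C$ whenever $|S|<2$ and $X\setminus S\notin\mathcal C$ whenever $|S|=2$. Let $\mathrm{Conn}(X)$ be the set of $2$-flimsy connectivities on $X$. A \emph{chord} of $X$ is an unordered pair of distinct points of $X$. A \emph{separation relation} on $X$ is a symmetric binary relation $\bot$ on chords such that: $\{a,b\}\not\perp\{a,c\}$ for all $a$ and all $b,c\ne a$; for any four distinct points $a,b,c,d$ exactly one of $\{a,b\}\bot\{c,d\}$, $\{a,c\}\bot\{b,d\}$, $\{a,d\}\bot\{b,c\}$ holds; for any five distinct points $a,b,c,d,e$ none or exactly two of $\{a,b\}\bot\{c,d\}$, $\{a,b\}\bot\{d,e\}$, $\{a,b\}\bot\{c,e\}$ hold. Its \emph{open intervals} are the sets $I_{\not\ni c}(a,b)=\{d\in X\setminus\{a,b,c\} : \{a,b\}\bot\{c,d\}\}$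 and $I_{\ni c}(a,b)=(X\setminus\{a,b\})\setminus I_{\not\ni c}(a,b)$ for distinct $a,b,c\in X$; its \emph{order topology} is the topology generated by the open intervals. It is \emph{dense} if $|X|\ge2$ and every chord is in relation $\bot$ with some chord, and \emph{order-complete} if for every open interval $I$ the union of any non-empty chain (for inclusion) of open intervals contained in $I$ is an open interval. Let $\mathrm{Sepa}(X)$ be the set of dense order-complete separation relations on $X$. Let $\Upsilon(\tau)$ be the set of connected subsets of $(X,\tau)$ (including $\emptyset$); let $\Phi(\mathcal C)$ be the relation on chords for which $\{a,b\}$ and $\{c,d\}$ are related exactly when $a,b,c,d$ are distinct and $c,d$ lie in distinct $\mathcal C$-components of $X\setminus\{a,b\}$; let $\Psi(\bot)$ be the order topology of $(X,\bot)$. \textbf{Theorem.} These define maps $\Upsilon\colon\mathrm{BCir}(X)\to\mathrm{Conn}(X)$, $\Phi\colon\mathrm{Conn}(X)\to\mathrm{Sepa}(X)$ and $\Psi\colon\mathrm{Sepa}(X)\to\mathrm{BCir}(X)$, and: (i) $\Psi(\Phi(\Upsilon(\tau)))=\tau$ for all $\tau\in\mathrm{BCir}(X)$; (ii) $\Upsilon(\Psi(\Phi(\mathcal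 C)))=\mathcal C$ for all $\mathcal C\in\mathrm{Conn}(X)$; (iii) $\Phi(\Upsilon(\Psi(\bot)))=\bot$ for all $\bot\in\mathrm{Sepa}(X)$. Hence $\Upsilon$, $\Phi$ and $\Psi$ are bijections. -/

import Mathlib

open Set

namespace CircleLike

universe u

/-! ### Big circles -/

/-- The linearly ordered topological space `L` is a big interval: the order is dense (with at least
two points), order-complete and has both ends, and the topology is the order topology. -/
structure IsBigInterval (L : Type u) [LinearOrder L] [TopologicalSpace L] : Prop where
  orderTopology : OrderTopology L
  nontrivial : Nontrivial L
  dense : ∀ x y : L, x < y → ∃ z, x < z ∧ z < y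
  complete : ∀ S : Set L, S.Nonempty → BddAbove S → ∃ s, IsLUB S s
  exists_min : ∃ m : L, IsBot m
  exists_max : ∃ m : L, IsTop m

/-- The relation generating the identification of the minimum with the maximum. -/
def EndsRel (L : Type u) [LinearOrder L] (x y : L) : Prop := IsBot x ∧ IsTop y

/-- `(X, τ)` is a big circle: it is (homeomorphic to) the quotient of a big interval obtained by
identifying its minimum and its maximum, with the quotient topology. Such a big interval has
cardinality at most that of `X` plus one, so taking it in the universe of `X` is no restriction. -/
def IsBigCircle {X : Type u} (τ : TopologicalSpace X) : Prop :=
  ∃ (L : Type u) (_ : LinearOrder L) (_ : TopologicalSpace L),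
    IsBigInterval L ∧ Nonempty (Quot (EndsRel L) ≃ₜ X)

/-! ### Connectivities -/

/-- The union of all members of `𝒞` that contain `y` and are contained in `Y`. If `𝒞` is a
connectivity and `y ∈ Y`, this is the `𝒞`-component of `Y` containing `y`. -/
def component {X : Type u} (𝒞 : Set (Set X)) (Y : Set X) (y : X) : Set X :=
  ⋃₀ {Z | Z ∈ 𝒞 ∧ y ∈ Z ∧ Z ⊆ Y}

/-- `𝒞` is a connectivity on `X`. In `sUnion_mem`, the intersection of the empty family is `X`
(so `∅ ∈ 𝒞` as soon as `X` is non-empty). -/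
structure IsConnectivity {X : Type u} (𝒞 : Set (Set X)) : Prop where
  singleton_mem : ∀ x : X, {x} ∈ 𝒞
  sUnion_mem : ∀ C : Set (Set X), C ⊆ 𝒞 → (⋂₀ C).Nonempty → ⋃₀ C ∈ 𝒞
  diff_component_mem : ∀ Y ∈ 𝒞, ∀ x ∈ Y, ∀ y ∈ Y, Y \ component 𝒞 (Y \ {x}) y ∈ 𝒞
  button_or_seam : ∀ A ∈ 𝒞, ∀ B ∈ 𝒞, A.Nonempty → B.Nonempty → A ∪ B ∈ 𝒞 →
    (∃ x ∈ A ∪ B, A ∪ {x} ∈ 𝒞 ∧ B ∪ {x} ∈ 𝒞) ∨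
    (∃ S ∈ 𝒞, S ⊆ A ∪ B ∧ (S ∩ A ∉ 𝒞 ∨ S ∩ B ∉ 𝒞))

/-- `X` has more than `n` points, stays `𝒞`-connected when fewer than `n` points are removed, and is
not `𝒞`-connected any more when exactly `n` points are removed. -/
structure IsFlimsy {X : Type u} (n : ℕ) (𝒞 : Set (Set X)) : Prop where
  lt_card : (n : ℕ∞) < ENat.card X
  compl_mem : ∀ S : Set X, S.encard < n → Sᶜ ∈ 𝒞
  compl_notMem : ∀ S : Set X, S.encard = n → Sᶜ ∉ 𝒞

/-! ### Separation relations -/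

/-- Chords: unordered pairs of distinct points. -/
def Chord (X : Type u) : Type u := {p : Sym2 X // ¬ p.IsDiag}

/-- A binary relation on the set of chords. -/
abbrev ChordRel (X : Type u) : Type u := Chord X → Chord X → Prop

/-- `{a, b}` and `{c, d}` are chords, and they are related by `R`. -/
def Cross {X : Type u} (R : ChordRel X) (a b c d : X) : Prop :=
  ∃ k l : Chord X, k.1 = s(a, b) ∧ l.1 = s(c, d) ∧ R k l

/-- `R` is a separation relation on `X`. -/
structure IsSeparation {X : Type u} (R : ChordRel X) : Prop where
  symm : ∀ k l : Chord X, R k l ↔ R l k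
  irrefl : ∀ a b c : X, b ≠ a → c ≠ a → ¬ Cross R a b a c
  total : ∀ a b c d : X, a ≠ b → a ≠ c → a ≠ d → b ≠ c → b ≠ d → c ≠ d →
    (Cross R a b c d ∧ ¬ Cross R a c b d ∧ ¬ Cross R a d b c) ∨
    (¬ Cross R a b c d ∧ Cross R a c b d ∧ ¬ Cross R a d b c) ∨
    (¬ Cross R a b c d ∧ ¬ Cross R a c b d ∧ Cross R a d b c)
  trans : ∀ a b c d e : X, a ≠ b → a ≠ c → a ≠ d → a ≠ e → b ≠ c → b ≠ d → b ≠ e →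
    c ≠ d → c ≠ e → d ≠ e →
    (¬ Cross R a b c d ∧ ¬ Cross R a b d e ∧ ¬ Cross R a b c e) ∨
    (Cross R a b c d ∧ Cross R a b d e ∧ ¬ Cross R a b c e) ∨
    (Cross R a b c d ∧ ¬ Cross R a b d e ∧ Cross R a b c e) ∨
    (¬ Cross R a b c d ∧ Cross R a b d e ∧ Cross R a b c e)

/-- The open interval between `a` and `b` that avoids `c`. -/
def intervalAvoiding {X : Type u} (R : ChordRel X) (a b c : X) : Set X :=
  {d | d ∉ ({a, b, c} : Set X) ∧ Cross R a b c d}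

/-- The open interval between `a` and `b` that contains `c`. -/
def intervalContaining {X : Type u} (R : ChordRel X) (a b c : X) : Set X :=
  ({a, b} : Set X)ᶜ \ intervalAvoiding R a b c

/-- `I` is an open interval of `(X, R)`. -/
def IsOpenInterval {X : Type u} (R : ChordRel X) (I : Set X) : Prop :=
  ∃ a b c : X, a ≠ b ∧ a ≠ c ∧ b ≠ c ∧
    (I = intervalAvoiding R a b c ∨ I = intervalContaining R a b c)

/-- `(X, R)` is dense. -/
def IsDense {X : Type u} (R : ChordRel X) : Prop :=
  Nontrivial X ∧ ∀ k : Chord X, ∃ l : Chord X, R k l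

/-- `(X, R)` is order-complete. -/
def IsOrderComplete {X : Type u} (R : ChordRel X) : Prop :=
  ∀ I : Set X, IsOpenInterval R I → ∀ 𝒰 : Set (Set X), 𝒰.Nonempty → IsChain (· ⊆ ·) 𝒰 →
    (∀ U ∈ 𝒰, IsOpenInterval R U ∧ U ⊆ I) → IsOpenInterval R (⋃₀ 𝒰)

/-! ### The three sets of structures on `X` -/

/-- The topologies on `X` that make it a big circle. -/
def BCir (X : Type u) : Set (TopologicalSpace X) := {τ | IsBigCircle τ}

/-- The connectivities on `X` that make it a `2`-flimsy connectivity space. -/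
def Conn (X : Type u) : Set (Set (Set X)) := {𝒞 | IsConnectivity 𝒞 ∧ IsFlimsy 2 𝒞}

/-- The dense and order-complete separation relations on `X`. -/
def Sepa (X : Type u) : Set (ChordRel X) :=
  {R | IsSeparation R ∧ IsDense R ∧ IsOrderComplete R}

/-! ### The three maps -/

/-- The set of all connected subsets of `(X, τ)`, where the empty set counts as connected. -/
def Upsilon {X : Type u} (τ : TopologicalSpace X) : Set (Set X) := {S | IsPreconnected S}

/-- The separation relation of `𝒞`: chords `{a, b}` and `{c, d}`, with `a, b, c, d` distinct, are
related when `c` and `d` lie in distinct `𝒞`-components of `X \ {a, b}`. -/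
def Phi {X : Type u} (𝒞 : Set (Set X)) : ChordRel X := fun k l =>
  ∃ a b c d : X, k.1 = s(a, b) ∧ l.1 = s(c, d) ∧
    a ≠ b ∧ a ≠ c ∧ a ≠ d ∧ b ≠ c ∧ b ≠ d ∧ c ≠ d ∧
    component 𝒞 ({a, b} : Set X)ᶜ c ≠ component 𝒞 ({a, b} : Set X)ᶜ d

/-- The order topology of `(X, R)`: the topology generated by the open intervals. -/
@[reducible] def Psi {X : Type u} (R : ChordRel X) : TopologicalSpace X :=
  TopologicalSpace.generateFrom {I | IsOpenInterval R I}

end CircleLike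

/-! A circle cut at a point is a linear order starting at that point, and all three structures are
governed by this order.

Let `R` be a dense separation relation and `p` a point. Reading "`y` is between `x` and `z`" as
"`{p, y}` separates `x` and `z`" gives a dense linear order with minimum `p` and no maximum, and `R`
is recovered from it as `sepOf X` (`IsSeparation.exists_linearOrder`). Order-completeness of `R`
amounts to the existence of suprema (`hasSups_of_isOrderComplete`, `isOrderComplete_sepOf`). Since
`p` is arbitrary, each question about `R` can be settled after cutting at the most convenient point.

The hub of the argument is `arcConvex R`, a combinatorial description of the connected sets. A set
missing `p` is arc-convex exactly when it is convex in the order cut at `p`, which makes the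
connectivity axioms checkable (`arcConvex_mem_Conn`). Three identities then close the triangle: the
connected sets of the order topology are the arc-convex ones (`Upsilon_Psi`); a relation is
recovered from its arc-convex sets (`Phi_arcConvex`); a 2-flimsy connectivity consists of the
arc-convex sets of its own relation (`arcConvex_Phi`). Finally, every big circle topology is some
`Psi R` (`exists_eq_Psi_of_mem_BCir`), so the loop at a topology reduces to the loop at `R`.

The substance on the connectivity side is that the complement of two points has exactly two
components (`component_eq_or`) and that one of the three pairings of four points crosses
(`cross_Phi_total`). Axiom (C4) serves to exclude gaps, that is, to produce suprema
(`hasSups_of_mem_Conn`). -/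

namespace CircleLike

universe u

variable {X : Type u}

/-! ### Relations on chords as relations on quadruples of points -/

section Cross

variable {R R' : ChordRel X} {a b c d : X}

theorem cross_comm_left : Cross R a b c d ↔ Cross R b a c d := by
  unfold Cross; rw [Sym2.eq_swap]

theorem cross_comm_right : Cross R a b c d ↔ Cross R a b d c := by
  unfold Cross; rw [Sym2.eq_swap (a := c)]

theorem Cross.ne_left (h : Cross R a b c d) : a ≠ b := by
  obtain ⟨k, l, hk, hl, -⟩ := h
  have := k.2
  rwa [hk, Sym2.mk_isDiag_iff] at this

theorem Cross.ne_right (h : Cross R a b c d) : c ≠ d := by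
  obtain ⟨k, l, hk, hl, -⟩ := h
  have := l.2
  rwa [hl, Sym2.mk_isDiag_iff] at this

theorem chordRel_ext (h : ∀ a b c d, Cross R a b c d ↔ Cross R' a b c d) : R = R' := by
  funext k l
  obtain ⟨⟨a, b⟩, hk⟩ := k
  obtain ⟨⟨c, d⟩, hl⟩ := l
  have key : ∀ Q : ChordRel X, Cross Q a b c d ↔ Q ⟨s(a, b), hk⟩ ⟨s(c, d), hl⟩ := by
    intro Q
    constructor
    · rintro ⟨k, l, h1, h2, h3⟩
      have e1 : k = ⟨s(a, b), hk⟩ := Subtype.ext h1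
      have e2 : l = ⟨s(c, d), hl⟩ := Subtype.ext h2
      rwa [← e1, ← e2]
    · exact fun h => ⟨_, _, rfl, rfl, h⟩
  exact propext ((key R).symm.trans ((h a b c d).trans (key R')))

/-- The relation on chords induced by a predicate on quadruples of points. -/
def ofQuad (P : X → X → X → X → Prop) : ChordRel X := fun k l =>
  ∃ a b c d : X, k.1 = s(a, b) ∧ l.1 = s(c, d) ∧ P a b c d

theorem cross_ofQuad {P : X → X → X → X → Prop} (h1 : ∀ a b c d, P a b c d → P b a c d)
    (h2 : ∀ a b c d, P a b c d → P a b d c) (h3 : ∀ a b c d, P a b c d → a ≠ b ∧ c ≠ d) :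
    Cross (ofQuad P) a b c d ↔ P a b c d := by
  constructor
  · rintro ⟨k, l, hk, hl, a', b', c', d', hk', hl', h⟩
    rw [hk, Sym2.eq_iff] at hk'
    rw [hl, Sym2.eq_iff] at hl'
    rcases hk' with ⟨rfl, rfl⟩ | ⟨rfl, rfl⟩ <;> rcases hl' with ⟨rfl, rfl⟩ | ⟨rfl, rfl⟩
    · exact h
    · exact h2 _ _ _ _ h
    · exact h1 _ _ _ _ h
    · exact h1 _ _ _ _ (h2 _ _ _ _ h)
  · intro h
    obtain ⟨hab, hcd⟩ := h3 _ _ _ _ h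
    exact ⟨⟨s(a, b), by rwa [Sym2.mk_isDiag_iff]⟩, ⟨s(c, d), by rwa [Sym2.mk_isDiag_iff]⟩,
      rfl, rfl, a, b, c, d, rfl, rfl, h⟩

namespace IsSeparation

theorem cross_symm (hR : IsSeparation R) : Cross R a b c d ↔ Cross R c d a b := by
  constructor
  · rintro ⟨k, l, h1, h2, h3⟩
    exact ⟨l, k, h2, h1, (hR.symm _ _).1 h3⟩
  · rintro ⟨k, l, h1, h2, h3⟩
    exact ⟨l, k, h2, h1, (hR.symm _ _).1 h3⟩

theorem distinct (hR : IsSeparation R) (h : Cross R a b c d) :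
    a ≠ b ∧ a ≠ c ∧ a ≠ d ∧ b ≠ c ∧ b ≠ d ∧ c ≠ d := by
  have hab := h.ne_left
  have hcd := h.ne_right
  have h1 : Cross R b a c d := cross_comm_left.1 h
  have h2 : Cross R a b d c := cross_comm_right.1 h
  have h3 : Cross R b a d c := cross_comm_right.1 h1
  refine ⟨hab, ?_, ?_, ?_, ?_, hcd⟩ <;> rintro rfl
  · exact hR.irrefl _ _ _ hab.symm hcd.symm h
  · exact hR.irrefl _ _ _ hab.symm hcd h2
  · exact hR.irrefl _ _ _ hab hcd.symm h1
  · exact hR.irrefl _ _ _ hab hcd h3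

/-- Whether `{a, b}` separates two points is transitive in the expected sense. -/
theorem cross_or (hR : IsSeparation R) {e : X} (h : Cross R a b c d) (ha : e ≠ a) (hb : e ≠ b) :
    Cross R a b c e ∨ Cross R a b e d := by
  by_cases hc : e = c
  · subst hc; exact Or.inr h
  by_cases hd : e = d
  · subst hd; exact Or.inl h
  obtain ⟨h1, h2, h3, h4, h5, h6⟩ := hR.distinct h
  have := hR.trans a b c d e h1 h2 h3 ha.symm h4 h5 hb.symm h6 (Ne.symm hc) (Ne.symm hd)
  have h7 : Cross R a b d e ↔ Cross R a b e d := cross_comm_right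
  tauto

theorem not_cross_rotate (hR : IsSeparation R) (h : Cross R a b c d) :
    ¬ Cross R a c b d ∧ ¬ Cross R a d b c := by
  obtain ⟨h1, h2, h3, h4, h5, h6⟩ := hR.distinct h
  have := hR.total a b c d h1 h2 h3 h4 h5 h6
  tauto

end IsSeparation

end Cross

/-- The arc-convex sets of a relation on chords: no chord disjoint from the set separates two of its
points. -/
def arcConvex (R : ChordRel X) : Set (Set X) :=
  {S | ∀ a b c d, Cross R a b c d → c ∈ S → d ∈ S → a ∈ S ∨ b ∈ S}

/-- `{a, b}` and `{c, d}` are disjoint chords, and exactly one of `c`, `d` lies strictly between `a`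
and `b`. -/
def Interlaced [LinearOrder X] (a b c d : X) : Prop :=
  a ≠ b ∧ a ≠ c ∧ a ≠ d ∧ b ≠ c ∧ b ≠ d ∧ c ≠ d ∧
    ((a < c ∧ c < b ∨ b < c ∧ c < a) ↔ ¬ (a < d ∧ d < b ∨ b < d ∧ d < a))

/-- The separation relation of the circle obtained by closing up a linear order. -/
def sepOf (X : Type u) [LinearOrder X] : ChordRel X := ofQuad (Interlaced (X := X))

/-! ### The separation relation of a linear order -/

section sepOf

variable [LinearOrder X] {a b c d : X}

theorem cross_sepOf : Cross (sepOf X) a b c d ↔ Interlaced a b c d := by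
  refine cross_ofQuad ?_ ?_ ?_ <;> unfold Interlaced <;> intro a b c d h
  · tauto
  · tauto
  · tauto

theorem Interlaced.symm (h : Interlaced a b c d) : Interlaced c d a b := by
  unfold Interlaced at *
  grind

theorem interlaced_total (h1 : a ≠ b) (h2 : a ≠ c) (h3 : a ≠ d) (h4 : b ≠ c) (h5 : b ≠ d)
    (h6 : c ≠ d) :
    (Interlaced a b c d ∧ ¬ Interlaced a c b d ∧ ¬ Interlaced a d b c) ∨
    (¬ Interlaced a b c d ∧ Interlaced a c b d ∧ ¬ Interlaced a d b c) ∨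
    (¬ Interlaced a b c d ∧ ¬ Interlaced a c b d ∧ Interlaced a d b c) := by
  simp only [Interlaced, h1, h2, h3, h4, h5, h6, h4.symm, h5.symm, h6.symm, ne_eq,
    not_false_eq_true, true_and]
  rcases h1.lt_or_gt with p1 | p1 <;> rcases h2.lt_or_gt with p2 | p2 <;>
  rcases h3.lt_or_gt with p3 | p3 <;> rcases h4.lt_or_gt with p4 | p4 <;>
  rcases h5.lt_or_gt with p5 | p5 <;> rcases h6.lt_or_gt with p6 | p6 <;>
  first
  | (exfalso; order)
  | simp only [p1, p2, p3, p4, p5, p6, p1.not_gt, p2.not_gt, p3.not_gt, p4.not_gt, p5.not_gt,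
      p6.not_gt, and_true, and_false, or_false, or_true, not_true_eq_false,
      not_false_eq_true, iff_false, iff_true, and_self, or_self]

theorem isSeparation_sepOf : IsSeparation (sepOf X) where
  symm := by
    have : ∀ k l, sepOf X k l → sepOf X l k := by
      rintro k l ⟨a, b, c, d, h1, h2, h⟩
      exact ⟨c, d, a, b, h2, h1, h.symm⟩
    exact fun k l => ⟨this k l, this l k⟩
  irrefl a b c _ _ h := by
    rw [cross_sepOf] at h
    exact h.2.1 rfl
  total a b c d h1 h2 h3 h4 h5 h6 := by
    simpa only [cross_sepOf] using interlaced_total h1 h2 h3 h4 h5 h6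
  trans a b c d e h1 h2 h3 h4 h5 h6 h7 h8 h9 h10 := by
    simp only [cross_sepOf, Interlaced, h1, h2, h3, h4, h5, h6, h7, h8, h9, h10, ne_eq,
      not_false_eq_true, true_and]
    generalize (a < c ∧ c < b ∨ b < c ∧ c < a) = p
    generalize (a < d ∧ d < b ∨ b < d ∧ d < a) = q
    generalize (a < e ∧ e < b ∨ b < e ∧ e < a) = r
    by_cases hp : p <;> by_cases hq : q <;> by_cases hr : r <;> simp [hp, hq, hr]

theorem isDense_sepOf [DenselyOrdered X] [NoMaxOrder X] [Nontrivial X] : IsDense (sepOf X) := by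
  refine ⟨inferInstance, ?_⟩
  rintro ⟨⟨a, b⟩, hk⟩
  have key : ∀ a b : X, a < b → ∃ c d, Interlaced a b c d := by
    intro a b h
    obtain ⟨c, h1, h2⟩ := exists_between h
    obtain ⟨d, h3⟩ := exists_gt b
    refine ⟨c, d, ?_⟩
    unfold Interlaced
    grind
  have hab : a ≠ b := by
    intro h; apply hk; exact Sym2.mk_isDiag_iff.2 h
  have : ∃ c d, Interlaced a b c d := by
    rcases lt_or_gt_of_ne hab with h | h
    · exact key a b h
    · obtain ⟨c, d, h⟩ := key b a h
      refine ⟨c, d, ?_⟩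
      unfold Interlaced at *
      grind
  obtain ⟨c, d, h⟩ := this
  refine ⟨⟨s(c, d), ?_⟩, a, b, c, d, rfl, rfl, h⟩
  rw [Sym2.mk_isDiag_iff]
  exact h.2.2.2.2.2.1

end sepOf

/-! ### Cutting a separation relation at a point -/

section CutOrder

variable {R : ChordRel X}

/-- The strict order on the circle cut at `p`: with `pos` selecting one of the two sides of `o`,
points on the other side come first, then `o`, then the points of the selected side. -/
def CutLT (R : ChordRel X) (p o : X) (pos : X → Prop) (x y : X) : Prop :=
  x ≠ y ∧ (x = p ∨ x ≠ p ∧ y ≠ p ∧ (x = o ∧ pos y ∨ y = o ∧ ¬ pos x ∨ x ≠ o ∧ y ≠ o ∧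
    (¬ pos x ∧ pos y ∨ ¬ pos x ∧ ¬ pos y ∧ Cross R p y o x ∨ pos x ∧ pos y ∧ Cross R p x o y)))

/-- By the five-point axiom, not being separated by `{p, o}` is an equivalence relation with at most
two classes. The reference point `n` names one of them, and `pos` is the other. -/
theorem IsSeparation.exists_side (hR : IsSeparation R) (p o n : X) (hnp : n ≠ p) (hno : n ≠ o) :
    ∃ pos : X → Prop, ∀ x y, x ≠ p → x ≠ o → y ≠ p → y ≠ o → x ≠ y →
      (Cross R p o x y ↔ (pos x ↔ ¬ pos y)) := by
  refine ⟨fun x => Cross R p o n x, fun x y hxp hxo hyp hyo hxy => ?_⟩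
  have irr : ¬ Cross R p o n n := fun h => h.ne_right rfl
  by_cases hxn : x = n
  · subst hxn; simp [irr]
  by_cases hyn : y = n
  · subst hyn; rw [cross_comm_right]; simp [irr]
  by_cases hpo : p = o
  · subst hpo
    have : ∀ u v, ¬ Cross R p p u v := fun u v h => h.ne_left rfl
    simp [this]
  have := hR.trans p o n x y hpo hnp.symm hxp.symm hyp.symm hno.symm hxo.symm hyo.symm
    (Ne.symm hxn) (Ne.symm hyn) hxy
  tauto

variable {p o : X} {pos : X → Prop} {x y z : X}

theorem cutLT_base_left (hop : o ≠ p) (hyp : y ≠ p) (hyo : y ≠ o) :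
    CutLT R p o pos o y ↔ pos y := by
  simp [CutLT, hop, hyp, hyo, hyo.symm]

theorem cutLT_base_right (hop : o ≠ p) (hxp : x ≠ p) (hxo : x ≠ o) :
    CutLT R p o pos x o ↔ ¬ pos x := by
  simp [CutLT, hop, hxp, hxo]

theorem cutLT_iff_of_ne (hxp : x ≠ p) (hxo : x ≠ o) (hyp : y ≠ p) (hyo : y ≠ o) :
    CutLT R p o pos x y ↔ x ≠ y ∧ (¬ pos x ∧ pos y ∨ ¬ pos x ∧ ¬ pos y ∧ Cross R p y o x ∨
      pos x ∧ pos y ∧ Cross R p x o y) := by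
  simp [CutLT, hyo, hxp, hxo, hyp]

theorem CutLT.ne_cut (h : CutLT R p o pos x y) : y ≠ p := by
  obtain ⟨h1, h2 | h2⟩ := h
  · subst h2; exact h1.symm
  · exact h2.2.1

/-- The crossing in the conclusion is the betweenness from which `R` is later recovered; it requires
`x ≠ p`, since `p` is an end of the chord. In each case on the sides of `o`, `cross_or` inserts the
fourth point into a known crossing and the four-point axiom discards the wrong alternative. -/
theorem IsSeparation.cutLT_trans (hR : IsSeparation R) (hop : o ≠ p)
    (hpos : ∀ x y, x ≠ p → x ≠ o → y ≠ p → y ≠ o → x ≠ y →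
      (Cross R p o x y ↔ (pos x ↔ ¬ pos y)))
    (hxp : x ≠ p) (hxy : CutLT R p o pos x y) (hyz : CutLT R p o pos y z) :
    CutLT R p o pos x z ∧ Cross R p y x z := by
  have hor : ∀ {y o z} x, Cross R p y o z → x ≠ p → x ≠ y → Cross R p y o x ∨ Cross R p y x z :=
    fun x h h1 h2 => hR.cross_or h h1 h2
  have hex : ∀ {y o z}, Cross R p y o z → ¬ Cross R p o y z ∧ ¬ Cross R p z y o :=
    fun h => hR.not_cross_rotate h
  have hsw : ∀ {y o z}, Cross R p y o z → Cross R p y z o := fun h => cross_comm_right.1 h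
  have hyp := hxy.ne_cut
  have hzp := hyz.ne_cut
  have nxy := hxy.1
  have nyz := hyz.1
  by_cases hxo : x = o
  · subst hxo
    rw [cutLT_base_left hop hyp nxy.symm] at hxy
    by_cases hzx : z = x
    · subst hzx
      rw [cutLT_base_right hop hyp nxy.symm] at hyz
      exact (hyz hxy).elim
    rw [cutLT_iff_of_ne hyp nxy.symm hzp hzx] at hyz
    rw [cutLT_base_left hop hzp hzx]
    obtain ⟨-, ⟨h, -⟩ | ⟨h, -⟩ | ⟨-, h1, h2⟩⟩ := hyz
    · exact (h hxy).elim
    · exact (h hxy).elim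
    · exact ⟨h1, h2⟩
  by_cases hzo : z = o
  · subst hzo
    rw [cutLT_base_right hop hyp nyz] at hyz
    rw [cutLT_iff_of_ne hxp hxo hyp nyz] at hxy
    rw [cutLT_base_right hop hxp hxo]
    obtain ⟨-, ⟨-, h⟩ | ⟨h1, -, h2⟩ | ⟨-, h, -⟩⟩ := hxy
    · exact (hyz h).elim
    · exact ⟨h1, hsw h2⟩
    · exact (hyz h).elim
  by_cases hyo : y = o
  · subst hyo
    rw [cutLT_base_right hop hxp hxo] at hxy
    rw [cutLT_base_left hop hzp hzo] at hyz
    have h3 : x ≠ z := by rintro rfl; exact hxy hyz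
    exact ⟨(cutLT_iff_of_ne hxp hxo hzp hzo).2 ⟨h3, Or.inl ⟨hxy, hyz⟩⟩,
      (hpos x z hxp hxo hzp hzo h3).2 (by simp [hxy, hyz])⟩
  rw [cutLT_iff_of_ne hxp hxo hyp hyo] at hxy
  rw [cutLT_iff_of_ne hyp hyo hzp hzo] at hyz
  rw [cutLT_iff_of_ne hxp hxo hzp hzo]
  have sxy := hpos x y hxp hxo hyp hyo nxy
  have syz := hpos y z hyp hyo hzp hzo nyz
  obtain ⟨-, hxy⟩ := hxy
  obtain ⟨-, hyz⟩ := hyz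
  rcases hyz with ⟨ny, pz⟩ | ⟨ny, nz, hyz⟩ | ⟨py, pz, hyz⟩
  · have hxy : ¬ pos x ∧ Cross R p y o x := by simpa [ny] using hxy
    have h1 : Cross R p o y z := syz.2 (by simp [ny, pz])
    have h3 := (hor z hxy.2 hzp nyz.symm).resolve_left (hex h1).1
    exact ⟨⟨h3.ne_right.symm, Or.inl ⟨hxy.1, pz⟩⟩, hsw h3⟩
  · have hxy : ¬ pos x ∧ Cross R p y o x := by simpa [ny] using hxy
    have h3 := (hor z hxy.2 hzp nyz.symm).resolve_left fun h => (hex hyz).2 (hsw h)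
    have h5 := (hor x hyz hxp h3.ne_right.symm).resolve_right fun h => (hex h3).1 (hsw h)
    exact ⟨⟨h3.ne_right.symm, Or.inr (Or.inl ⟨hxy.1, nz, h5⟩)⟩, hsw h3⟩
  · by_cases px : pos x
    · have hxy : Cross R p x o y := by simpa [px, py] using hxy
      have h3 := (hor x hyz hxp nxy).resolve_left fun h => (hex hxy).2 (hsw h)
      have h4 := (hor z hxy hzp h3.ne_right.symm).resolve_right fun h => (hex h3).1 (hsw h)
      exact ⟨⟨h3.ne_right, Or.inr (Or.inr ⟨px, pz, h4⟩)⟩, h3⟩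
    · have h1 : Cross R p o x y := sxy.2 (by simp [px, py])
      have h3 := (hor x hyz hxp nxy).resolve_left fun h => (hex h1).2 h
      exact ⟨⟨h3.ne_right, Or.inl ⟨px, pz⟩⟩, h3⟩

theorem IsSeparation.cutLT_total (hR : IsSeparation R) (hop : o ≠ p)
    (hpos : ∀ x y, x ≠ p → x ≠ o → y ≠ p → y ≠ o → x ≠ y →
      (Cross R p o x y ↔ (pos x ↔ ¬ pos y)))
    (hxy : x ≠ y) : CutLT R p o pos x y ∨ CutLT R p o pos y x := by
  by_cases hxp : x = p
  · exact Or.inl ⟨hxy, Or.inl hxp⟩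
  by_cases hyp : y = p
  · exact Or.inr ⟨hxy.symm, Or.inl hyp⟩
  by_cases hxo : x = o
  · subst hxo
    rw [cutLT_base_left hop hyp hxy.symm, cutLT_base_right hop hyp hxy.symm]
    exact em _
  by_cases hyo : y = o
  · subst hyo
    rw [cutLT_base_left hop hxp hxy, cutLT_base_right hop hxp hxy]
    exact (em _).symm
  rw [cutLT_iff_of_ne hxp hxo hyp hyo, cutLT_iff_of_ne hyp hyo hxp hxo]
  have h1 := hpos x y hxp hxo hyp hyo hxy
  have h2 := hR.total p o x y hop.symm (Ne.symm hxp) (Ne.symm hyp) (Ne.symm hxo) (Ne.symm hyo) hxy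
  by_cases px : pos x <;> by_cases py : pos y <;> simp [px, py, hxy, hxy.symm] at h1 ⊢ <;> tauto

theorem IsSeparation.cutLT_asymm (hR : IsSeparation R) (hop : o ≠ p)
    (hxy : CutLT R p o pos x y) : ¬ CutLT R p o pos y x := by
  intro hyx
  have hxp := hyx.ne_cut
  have hyp := hxy.ne_cut
  have nxy := hxy.1
  by_cases hxo : x = o
  · subst hxo
    rw [cutLT_base_left hop hyp nxy.symm] at hxy
    rw [cutLT_base_right hop hyp nxy.symm] at hyx
    exact hyx hxy
  by_cases hyo : y = o
  · subst hyo
    rw [cutLT_base_left hop hxp nxy] at hyx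
    rw [cutLT_base_right hop hxp nxy] at hxy
    exact hxy hyx
  have hex : Cross R p x o y → ¬ Cross R p y o x :=
    fun h h' => (hR.not_cross_rotate (cross_comm_right.1 h)).1 (cross_comm_right.1 h')
  rw [cutLT_iff_of_ne hxp hxo hyp hyo] at hxy
  rw [cutLT_iff_of_ne hyp hyo hxp hxo] at hyx
  by_cases px : pos x <;> by_cases py : pos y <;> simp [px, py] at hxy hyx <;> tauto

/-- A circle can be cut at any of its points. -/
theorem IsSeparation.exists_linearOrder (hR : IsSeparation R) (hD : IsDense R) (p : X) :
    ∃ (_ : LinearOrder X) (_ : OrderBot X), (⊥ : X) = p ∧ DenselyOrdered X ∧ NoMaxOrder X ∧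
      R = sepOf X := by
  classical
  obtain ⟨hX, hd⟩ := hD
  have hd' : ∀ a b : X, a ≠ b → ∃ c d, Cross R a b c d := by
    intro a b hab
    obtain ⟨⟨⟨c, d⟩, hl⟩, h⟩ := hd ⟨s(a, b), by rwa [Sym2.mk_isDiag_iff]⟩
    exact ⟨c, d, _, _, rfl, rfl, h⟩
  obtain ⟨o, hop⟩ := exists_ne p
  obtain ⟨n, m, hnm⟩ := hd' p o hop.symm
  obtain ⟨-, hn1, -, hn2, -, -⟩ := hR.distinct hnm
  obtain ⟨pos, hpos⟩ := hR.exists_side p o n hn1.symm hn2.symm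
  have bot_lt : ∀ x, x ≠ p → CutLT R p o pos p x := fun x hx => ⟨hx.symm, Or.inl rfl⟩
  have lt_bot : ∀ x, ¬ CutLT R p o pos x p := fun x hx => by
    obtain ⟨h1, h2⟩ := hx
    tauto
  have tr : ∀ x y z, CutLT R p o pos x y → CutLT R p o pos y z → CutLT R p o pos x z := by
    intro x y z hxy hyz
    by_cases hxp : x = p
    · subst hxp
      apply bot_lt
      rintro rfl
      exact lt_bot _ hyz
    · exact (hR.cutLT_trans hop hpos hxp hxy hyz).1
  let ord : LinearOrder X :=
    { le := fun x y => x = y ∨ CutLT R p o pos x y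
      lt := CutLT R p o pos
      le_refl := fun x => Or.inl rfl
      le_trans := by
        rintro x y z (rfl | hxy) (rfl | hyz)
        · exact Or.inl rfl
        · exact Or.inr hyz
        · exact Or.inr hxy
        · exact Or.inr (tr _ _ _ hxy hyz)
      lt_iff_le_not_ge := by
        intro x y
        constructor
        · intro h
          refine ⟨Or.inr h, ?_⟩
          rintro (h' | h')
          · exact h.1 h'.symm
          · exact hR.cutLT_asymm hop h h'
        · rintro ⟨rfl | h, h'⟩
          · exact (h' (Or.inl rfl)).elim
          · exact h
      le_antisymm := by
        rintro x y (rfl | hxy) (h | hyx)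
        · rfl
        · rfl
        · exact h.symm
        · exact (hR.cutLT_asymm hop hxy hyx).elim
      le_total := by
        intro x y
        by_cases h : x = y
        · exact Or.inl (Or.inl h)
        · exact (hR.cutLT_total hop hpos h).imp Or.inr Or.inr
      toDecidableLE := Classical.decRel _ }
  have lt_def : ∀ x y : X, x < y ↔ CutLT R p o pos x y := fun x y => Iff.rfl
  let bt : OrderBot X :=
    { bot := p
      bot_le := fun x => by
        by_cases h : x = p
        · exact Or.inl h.symm
        · exact Or.inr (bot_lt x h) }
  have mid : ∀ x y z, x ≠ p → x < y → y < z → Cross R p y x z := fun x y z hx hxy hyz =>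
    (hR.cutLT_trans hop hpos hx hxy hyz).2
  have ppos : ∀ x, x ≠ p → p < x := bot_lt
  have btw : ∀ x y z, x ≠ p → y ≠ p → z ≠ p → x ≠ y → x ≠ z → y ≠ z →
      (Cross R p y x z ↔ (x < y ∧ y < z ∨ z < y ∧ y < x)) := by
    intro x y z hx hy hz hxy hxz hyz
    constructor
    · intro h
      -- If `y` is not the middle point, then `x` or `z` is, and `mid` gives a crossing of another
      -- pairing of the same four points.
      by_contra hcon
      have h1 := hR.not_cross_rotate h
      rcases lt_or_gt_of_ne hxy with h2 | h2 <;> rcases lt_or_gt_of_ne hyz with h3 | h3 <;>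
        rcases lt_or_gt_of_ne hxz with h4 | h4
      · exact hcon (Or.inl ⟨h2, h3⟩)
      · exact hcon (Or.inl ⟨h2, h3⟩)
      · exact h1.2 (cross_comm_right.1 (mid _ _ _ hx h4 h3))
      · exact h1.1 (cross_comm_right.1 (mid _ _ _ hz h4 h2))
      · exact h1.1 (mid _ _ _ hy h2 h4)
      · exact h1.2 (mid _ _ _ hy h3 h4)
      · exact hcon (Or.inr ⟨h3, h2⟩)
      · exact hcon (Or.inr ⟨h3, h2⟩)
    · rintro (⟨h1, h2⟩ | ⟨h1, h2⟩)
      · exact mid _ _ _ hx h1 h2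
      · exact cross_comm_right.1 (mid _ _ _ hz h1 h2)
  have hp0 : ∀ b c d, p ≠ b → p ≠ c → p ≠ d → b ≠ c → b ≠ d → c ≠ d →
      (Cross R p b c d ↔ Interlaced p b c d) := by
    intro b c d h1 h2 h3 h4 h5 h6
    rw [btw c b d h2.symm h1.symm h3.symm h4.symm h6 h5]
    have l1 := ppos b h1.symm
    have l2 := ppos c h2.symm
    have l3 := ppos d h3.symm
    unfold Interlaced
    simp only [h1, h2, h3, h4, h5, h6, l2, l3, ne_eq, not_false_eq_true, true_and, l2.not_gt,
      l3.not_gt, and_false, or_false]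
    rcases h4.lt_or_gt with q1 | q1 <;> rcases h5.lt_or_gt with q2 | q2 <;>
      simp [q1, q2, q1.not_gt, q2.not_gt]
  have heq : R = sepOf X := by
    apply chordRel_ext
    intro a b c d
    rw [cross_sepOf]
    by_cases hne : a ≠ b ∧ a ≠ c ∧ a ≠ d ∧ b ≠ c ∧ b ≠ d ∧ c ≠ d
    swap
    · exact ⟨fun h => (hne (hR.distinct h)).elim,
        fun h => (hne ⟨h.1, h.2.1, h.2.2.1, h.2.2.2.1, h.2.2.2.2.1, h.2.2.2.2.2.1⟩).elim⟩
    have hS := isSeparation_sepOf (X := X)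
    have hp1 : ∀ b c d, p ≠ b → p ≠ c → p ≠ d → b ≠ c → b ≠ d → c ≠ d →
      (Cross R p b c d ↔ Cross (sepOf X) p b c d) := by
      simpa only [cross_sepOf] using hp0
    rw [← cross_sepOf]
    obtain ⟨h1, h2, h3, h4, h5, h6⟩ := hne
    have c1 : ∀ {Q : ChordRel X} {a b c d : X}, Cross Q a b c d ↔ Cross Q b a c d :=
      cross_comm_left
    have c2 : ∀ {Q : ChordRel X} {a b c d : X}, Cross Q a b c d ↔ Cross Q a b d c :=
      cross_comm_right
    by_cases ha : p = a
    · subst ha; exact hp1 _ _ _ h1 h2 h3 h4 h5 h6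
    by_cases hb : p = b
    · subst hb; rw [c1, c1 (Q := sepOf X)]; exact hp1 _ _ _ h1.symm h4 h5 h2 h3 h6
    by_cases hc : p = c
    · subst hc; rw [hR.cross_symm, hS.cross_symm]
      exact hp1 _ _ _ h6 h2.symm h4.symm h3.symm h5.symm h1
    by_cases hd : p = d
    · subst hd; rw [hR.cross_symm, hS.cross_symm, c1, c1 (Q := sepOf X)]
      exact hp1 _ _ _ h6.symm h3.symm h5.symm h2.symm h4.symm h1
    -- For a quadruple avoiding `p`, the five-point axiom with fifth point `p` says that `{a, b}`
    -- separates `c` from `d` exactly when it separates one and only one of them from `p`. So a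
    -- separation relation is determined by its quadruples through `p`.
    have key : ∀ {Q : ChordRel X}, IsSeparation Q →
        (Cross Q a b c d ↔ (Cross Q p c a b ↔ ¬ Cross Q p d a b)) := by
      intro Q hQ
      have e1 : Cross Q p c a b ↔ Cross Q a b c p := by
        rw [hQ.cross_symm, c2]
      have e2 : Cross Q p d a b ↔ Cross Q a b d p := by
        rw [hQ.cross_symm, c2]
      have := hQ.trans a b c d p h1 h2 h3 (Ne.symm ha) h4 h5 (Ne.symm hb) h6 (Ne.symm hc)
        (Ne.symm hd)
      tauto
    rw [key hR, key hS, hp1 c a b hc ha hb h2.symm h4.symm h1,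
      hp1 d a b hd ha hb h3.symm h5.symm h1]
  refine ⟨ord, bt, rfl, ⟨?_⟩, ⟨?_⟩, heq⟩
  · intro a b hab
    -- Of two points separated by `{a, b}`, exactly one lies strictly between `a` and `b`.
    obtain ⟨c, d, h⟩ := hd' a b hab.ne
    rw [heq, cross_sepOf] at h
    unfold Interlaced at h
    have h' := h.2.2.2.2.2.2
    have n1 : ∀ e, ¬ (b < e ∧ e < a) := fun e he => hab.not_gt (he.1.trans he.2)
    simp only [n1, or_false] at h'
    by_cases h1 : a < c ∧ c < b
    · exact ⟨c, h1⟩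
    · exact ⟨d, by tauto⟩
  · intro b
    by_cases hb : b = p
    · subst hb; exact ⟨o, ppos o hop⟩
    obtain ⟨c, d, h⟩ := hd' p b (Ne.symm hb)
    rw [heq, cross_sepOf] at h
    unfold Interlaced at h
    by_contra! hmax
    have h1 := (hmax c).lt_of_ne h.2.2.2.1.symm
    have h2 := (hmax d).lt_of_ne h.2.2.2.2.1.symm
    have := h.2.2.2.2.2.2.1 (Or.inl ⟨ppos c h.2.1.symm, h1⟩)
    exact this (Or.inl ⟨ppos d h.2.2.1.symm, h2⟩)

end CutOrder

/-! ### Open intervals in the cut order, and order-completeness as existence of suprema -/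

theorem intervalAvoiding_comm {R : ChordRel X} {a b c : X} :
    intervalAvoiding R a b c = intervalAvoiding R b a c := by
  ext d
  simp only [intervalAvoiding, mem_ofPred_eq, cross_comm_left (a := a), insert_comm a b]

theorem intervalContaining_comm {R : ChordRel X} {a b c : X} :
    intervalContaining R a b c = intervalContaining R b a c := by
  rw [intervalContaining, intervalContaining, intervalAvoiding_comm, pair_comm]

section Intervals

variable [LinearOrder X] {a b c d : X}

theorem interlaced_of_lt (h : a < b) : Interlaced a b c d ↔
    (c ∈ Ioo a b ∧ d ∈ (Icc a b)ᶜ) ∨ (c ∈ (Icc a b)ᶜ ∧ d ∈ Ioo a b) := by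
  have n1 : ∀ e, ¬ (b < e ∧ e < a) := fun e he => h.not_gt (he.1.trans he.2)
  have out : ∀ e, e ≠ a → e ≠ b → (e ∈ (Icc a b)ᶜ ↔ ¬ (a < e ∧ e < b)) := by
    intro e h1 h2
    rw [mem_compl_iff, mem_Icc, not_iff_not]
    exact ⟨fun h => ⟨h.1.lt_of_ne h1.symm, h.2.lt_of_ne h2⟩, fun h => ⟨h.1.le, h.2.le⟩⟩
  have ne1 : ∀ {e}, e ∈ Ioo a b → e ≠ a ∧ e ≠ b := fun he => ⟨he.1.ne', he.2.ne⟩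
  have ne2 : ∀ {e}, e ∈ (Icc a b)ᶜ → e ≠ a ∧ e ≠ b := by
    rintro e he
    constructor <;> rintro rfl
    · exact he (left_mem_Icc.2 h.le)
    · exact he (right_mem_Icc.2 h.le)
  have disj : ∀ {e}, e ∈ Ioo a b → e ∉ (Icc a b)ᶜ := fun he h => h ⟨he.1.le, he.2.le⟩
  constructor
  · rintro ⟨-, h1, h2, h3, h4, -, h5⟩
    rw [out c h1.symm h3.symm, out d h2.symm h4.symm, mem_Ioo, mem_Ioo]
    simp only [n1, or_false] at h5
    tauto
  · intro hcd
    have hc : c ≠ a ∧ c ≠ b := by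
      rcases hcd with hcd | hcd
      exacts [ne1 hcd.1, ne2 hcd.1]
    have hd : d ≠ a ∧ d ≠ b := by
      rcases hcd with hcd | hcd
      exacts [ne2 hcd.2, ne1 hcd.2]
    have hne : c ≠ d := by
      rintro rfl
      rcases hcd with hcd | hcd
      exacts [disj hcd.1 hcd.2, disj hcd.2 hcd.1]
    refine ⟨h.ne, hc.1.symm, hd.1.symm, hc.2.symm, hd.2.symm, hne, ?_⟩
    rw [out c hc.1 hc.2, out d hd.1 hd.2, mem_Ioo, mem_Ioo] at hcd
    simp only [n1, or_false]
    tauto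

theorem intervalAvoiding_sepOf_of_mem (hc : c ∈ Ioo a b) :
    intervalAvoiding (sepOf X) a b c = (Icc a b)ᶜ := by
  have h := hc.1.trans hc.2
  ext d
  simp only [intervalAvoiding, mem_ofPred_eq, cross_sepOf]
  constructor
  · rintro ⟨-, h1⟩
    rcases (interlaced_of_lt h).1 h1 with h2 | h2
    · exact h2.2
    · exact (h2.1 ⟨hc.1.le, hc.2.le⟩).elim
  · intro hd
    have := (interlaced_of_lt h).2 (Or.inl ⟨hc, hd⟩)
    obtain ⟨-, h1, h2, h3, h4, h5, -⟩ := id this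
    refine ⟨by simp [h2.symm, h4.symm, h5.symm], this⟩

theorem intervalAvoiding_sepOf_of_notMem (h : a < b) (hc : c ∈ (Icc a b)ᶜ) :
    intervalAvoiding (sepOf X) a b c = Ioo a b := by
  ext d
  simp only [intervalAvoiding, mem_ofPred_eq, cross_sepOf]
  constructor
  · rintro ⟨-, h1⟩
    rcases (interlaced_of_lt h).1 h1 with h2 | h2
    · exact (hc ⟨h2.1.1.le, h2.1.2.le⟩).elim
    · exact h2.2
  · intro hd
    have := (interlaced_of_lt h).2 (Or.inr ⟨hc, hd⟩)
    obtain ⟨-, h1, h2, h3, h4, h5, -⟩ := id this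
    refine ⟨by simp [h2.symm, h4.symm, h5.symm], this⟩

theorem pair_compl_diff_Ioo (h : a < b) : ({a, b} : Set X)ᶜ \ Ioo a b = (Icc a b)ᶜ := by
  ext x
  simp only [mem_sdiff, mem_compl_iff, mem_insert_iff, mem_singleton_iff, mem_Ioo, mem_Icc, not_or]
  constructor
  · rintro ⟨⟨h1, h2⟩, h3⟩ ⟨h4, h5⟩
    exact h3 ⟨h4.lt_of_ne (Ne.symm h1), h5.lt_of_ne h2⟩
  · intro h1
    refine ⟨⟨?_, ?_⟩, fun h2 => h1 ⟨h2.1.le, h2.2.le⟩⟩ <;> rintro rfl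
    · exact h1 ⟨le_rfl, h.le⟩
    · exact h1 ⟨h.le, le_rfl⟩

theorem pair_compl_diff_Icc_compl (a b : X) : ({a, b} : Set X)ᶜ \ (Icc a b)ᶜ = Ioo a b := by
  rw [← Icc_sdiff_both, sdiff_eq, compl_compl, sdiff_eq, inter_comm]

theorem isOpenInterval_sepOf [DenselyOrdered X] [NoMaxOrder X] {I : Set X} :
    IsOpenInterval (sepOf X) I ↔ ∃ x y : X, x < y ∧ (I = Ioo x y ∨ I = (Icc x y)ᶜ) := by
  constructor
  · have key : ∀ a b c : X, a < b → a ≠ c → b ≠ c → (I = intervalAvoiding (sepOf X) a b c ∨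
        I = intervalContaining (sepOf X) a b c) → (I = Ioo a b ∨ I = (Icc a b)ᶜ) := by
      intro a b c hab hac hbc hI
      by_cases hc : c ∈ Ioo a b
      · rw [intervalContaining, intervalAvoiding_sepOf_of_mem hc, pair_compl_diff_Icc_compl] at hI
        exact hI.symm
      · have hc : c ∈ (Icc a b)ᶜ := fun h => hc ⟨h.1.lt_of_ne hac, h.2.lt_of_ne hbc.symm⟩
        rwa [intervalContaining, intervalAvoiding_sepOf_of_notMem hab hc,
          pair_compl_diff_Ioo hab] at hI
    rintro ⟨a, b, c, hab, hac, hbc, hI⟩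
    rcases hab.lt_or_gt with h | h
    · exact ⟨a, b, h, key a b c h hac hbc hI⟩
    · rw [intervalAvoiding_comm, intervalContaining_comm] at hI
      exact ⟨b, a, h, key b a c h hbc hac hI⟩
  · rintro ⟨x, y, h, hI⟩
    obtain ⟨z, hz⟩ := exists_between h
    refine ⟨x, y, z, h.ne, hz.1.ne, hz.2.ne', ?_⟩
    rwa [intervalContaining, intervalAvoiding_sepOf_of_mem hz, pair_compl_diff_Icc_compl, or_comm]

/-- Every non-empty set with an upper bound has a least upper bound. -/
def HasSups (X : Type u) [LinearOrder X] : Prop :=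
  ∀ S : Set X, S.Nonempty → BddAbove S → ∃ s, IsLUB S s

/-- The intervals `Ioo ⊥ s` with `s ∈ S` form a chain, and the right end of their union is the
supremum of `S`. The union is bounded above, so it cannot be the complement of a closed interval. -/
theorem hasSups_of_isOrderComplete [OrderBot X] [DenselyOrdered X] [NoMaxOrder X]
    (h : IsOrderComplete (sepOf X)) : HasSups X := by
  rintro S hS ⟨u, hu⟩
  by_cases hbot : ∃ s ∈ S, ⊥ < s
  swap
  · push Not at hbot
    obtain ⟨s, hs⟩ := hS
    exact ⟨⊥, fun t ht => hbot t ht, fun _ _ => bot_le⟩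
  obtain ⟨s0, hs0, hpos⟩ := hbot
  obtain ⟨v, hv⟩ := exists_gt u
  have hbv : ⊥ < v := hpos.trans_le ((hu hs0).trans hv.le)
  have hW := h (Ioo ⊥ v) (isOpenInterval_sepOf.2 ⟨_, _, hbv, Or.inl rfl⟩)
    {U | ∃ s ∈ S, ⊥ < s ∧ U = Ioo ⊥ s} ⟨_, s0, hs0, hpos, rfl⟩
    (by
      rintro _ ⟨s, -, -, rfl⟩ _ ⟨t, -, -, rfl⟩ -
      rcases le_total s t with h | h
      · exact Or.inl (Ioo_subset_Ioo_right h)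
      · exact Or.inr (Ioo_subset_Ioo_right h))
    (by
      rintro _ ⟨s, hs, hs', rfl⟩
      exact ⟨isOpenInterval_sepOf.2 ⟨_, _, hs', Or.inl rfl⟩,
        Ioo_subset_Ioo_right ((hu hs).trans hv.le)⟩)
  set W := ⋃₀ {U | ∃ s ∈ S, ⊥ < s ∧ U = Ioo ⊥ s} with hWdef
  have mem : ∀ z, z ∈ W ↔ ∃ s ∈ S, ⊥ < z ∧ z < s := by
    intro z
    constructor
    · rintro ⟨_, ⟨s, hs, -, rfl⟩, hz⟩
      exact ⟨s, hs, hz.1, hz.2⟩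
    · rintro ⟨s, hs, h1, h2⟩
      exact ⟨_, ⟨s, hs, h1.trans h2, rfl⟩, h1, h2⟩
  obtain ⟨x, y, hxy, hI | hI⟩ := isOpenInterval_sepOf.1 hW
  · refine ⟨y, fun s hs => ?_, fun w hw => ?_⟩
    · by_contra! hlt
      have : y ∈ W := (mem y).2 ⟨s, hs, bot_le.trans_lt hxy, hlt⟩
      rw [hI] at this
      exact this.2.false
    · by_contra! hlt
      obtain ⟨z, hz1, hz2⟩ := exists_between (max_lt hxy hlt)
      have : z ∈ W := by
        rw [hI]; exact ⟨(le_max_left _ _).trans_lt hz1, hz2⟩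
      obtain ⟨s, hs, -, hzs⟩ := (mem z).1 this
      exact (hw hs).not_gt (((le_max_right _ _).trans_lt hz1).trans hzs)
  · obtain ⟨z, hz⟩ := exists_gt (max y v)
    have : z ∈ W := by
      rw [hI]; exact fun h => h.2.not_gt ((le_max_left _ _).trans_lt hz)
    obtain ⟨s, hs, -, hzs⟩ := (mem z).1 this
    exact ((hzs.trans_le (hu hs)).trans hv).not_gt ((le_max_right _ _).trans_lt hz) |>.elim

theorem HasSups.exists_isGLB [OrderBot X] (h : HasSups X) {S : Set X} (hS : S.Nonempty) :
    ∃ s, IsGLB S s := by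
  obtain ⟨t, ht⟩ := hS
  obtain ⟨s, hs⟩ := h (lowerBounds S) ⟨⊥, fun _ _ => bot_le⟩ ⟨t, fun x hx => hx ht⟩
  exact ⟨s, isLUB_lowerBounds.1 hs⟩

/-- A non-empty convex set without extremal points is an interval between its bounds. -/
theorem eq_Ioo_or_eq_Ioi [OrderBot X] (h : HasSups X) {W : Set X} (hW : W.Nonempty)
    (hconv : W.OrdConnected) (hmin : ∀ x ∈ W, ∃ y ∈ W, y < x) (hmax : ∀ x ∈ W, ∃ y ∈ W, x < y) :
    (∃ x y, x < y ∧ W = Ioo x y) ∨ ∃ x, W = Ioi x := by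
  obtain ⟨x, hx⟩ := h.exists_isGLB hW
  have hxW : ∀ z ∈ W, x < z := fun z hz => by
    obtain ⟨y, hy, hyz⟩ := hmin z hz
    exact (hx.1 hy).trans_lt hyz
  have low : ∀ z, x < z → ∃ w ∈ W, w < z := fun z hz => by
    by_contra! hcon
    exact hz.not_ge (hx.2 hcon)
  by_cases hb : BddAbove W
  · obtain ⟨y, hy⟩ := h W hW hb
    have hyW : ∀ z ∈ W, z < y := fun z hz => by
      obtain ⟨t, ht, hzt⟩ := hmax z hz
      exact hzt.trans_le (hy.1 ht)
    obtain ⟨w, hw⟩ := hW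
    refine Or.inl ⟨x, y, (hxW w hw).trans (hyW w hw), Subset.antisymm
      (fun z hz => ⟨hxW z hz, hyW z hz⟩) ?_⟩
    rintro z ⟨hz1, hz2⟩
    obtain ⟨s, hs, hsz⟩ := low z hz1
    have : ∃ t ∈ W, z < t := by
      by_contra! hcon
      exact hz2.not_ge (hy.2 hcon)
    obtain ⟨t, ht, hzt⟩ := this
    exact hconv.out hs ht ⟨hsz.le, hzt.le⟩
  · refine Or.inr ⟨x, Subset.antisymm hxW fun z hz => ?_⟩
    obtain ⟨s, hs, hsz⟩ := low z hz
    have : ∃ t ∈ W, z < t := by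
      by_contra! hcon
      exact hb ⟨z, hcon⟩
    obtain ⟨t, ht, hzt⟩ := this
    exact hconv.out hs ht ⟨hsz.le, hzt.le⟩

theorem Icc_compl_eq_Ioi [OrderBot X] {x y : X} (hb : (⊥ : X) ∉ (Icc x y)ᶜ) :
    (Icc x y)ᶜ = Ioi y := by
  have hx : x = ⊥ := by
    by_contra hne
    exact hb fun h => hne (le_bot_iff.1 h.1)
  subst hx
  ext z
  simp

/-- If the union `W` contains `⊥`, cofinally many members are complements of closed intervals, and
`Wᶜ` is the closed interval between its own bounds. Otherwise `W` is convex without extremal points,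
hence `Ioo x y` or `Ioi x`. The ambient interval `I` misses at least two points, which keeps the
limiting interval nondegenerate. -/
theorem isOrderComplete_sepOf [OrderBot X] [DenselyOrdered X] [NoMaxOrder X] (h : HasSups X) :
    IsOrderComplete (sepOf X) := by
  intro I hI 𝒰 hne hchain hU
  set W := ⋃₀ 𝒰 with hW
  have hWI : W ⊆ I := sUnion_subset fun U hU' => (hU U hU').2
  rw [isOpenInterval_sepOf]
  by_cases hbot : ⊥ ∈ W
  · obtain ⟨U0, hU0, hb0⟩ := hbot
    have hout : ∀ U ∈ 𝒰, ⊥ ∈ U → ∃ x y, x < y ∧ U = (Icc x y)ᶜ := by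
      intro U hU' hb
      obtain ⟨x, y, hxy, hc | hc⟩ := isOpenInterval_sepOf.1 (hU U hU').1
      · rw [hc] at hb
        exact (not_lt_bot hb.1).elim
      · exact ⟨x, y, hxy, hc⟩
    have hbig : ∀ w ∈ W, ∃ x y, x < y ∧ Wᶜ ⊆ Icc x y ∧ w ∉ Icc x y := by
      rintro w ⟨U1, hU1, hw⟩
      have : ∃ U ∈ 𝒰, w ∈ U ∧ ⊥ ∈ U := by
        rcases hchain.total hU0 hU1 with hs | hs
        · exact ⟨U1, hU1, hw, hs hb0⟩
        · exact ⟨U0, hU0, hs hw, hb0⟩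
      obtain ⟨U, hU', hwU, hbU⟩ := this
      obtain ⟨x, y, hxy, rfl⟩ := hout U hU' hbU
      refine ⟨x, y, hxy, ?_, hwU⟩
      rw [compl_subset_comm]
      exact subset_sUnion_of_mem hU'
    have hIc : ∃ a b : X, a < b ∧ a ∉ W ∧ b ∉ W := by
      obtain ⟨a, b, hab, hI' | hI'⟩ := isOpenInterval_sepOf.1 hI
      · exact ⟨a, b, hab, fun h => (by have := hWI h; rw [hI'] at this; exact this.1.false),
          fun h => (by have := hWI h; rw [hI'] at this; exact this.2.false)⟩
      · refine ⟨a, b, hab, fun h => ?_, fun h => ?_⟩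
        · have := hWI h
          rw [hI'] at this
          exact this (left_mem_Icc.2 hab.le)
        · have := hWI h
          rw [hI'] at this
          exact this (right_mem_Icc.2 hab.le)
    obtain ⟨a, b, hab, ha, hb⟩ := hIc
    obtain ⟨x0, y0, -, hsub0, -⟩ := hbig ⊥ ⟨U0, hU0, hb0⟩
    obtain ⟨x, hx⟩ := h.exists_isGLB (S := Wᶜ) ⟨a, ha⟩
    obtain ⟨y, hy⟩ := h Wᶜ ⟨a, ha⟩ ⟨y0, fun z hz => (hsub0 hz).2⟩
    refine ⟨x, y, (hx.1 ha).trans_lt (hab.trans_le (hy.1 hb)), Or.inr ?_⟩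
    rw [eq_compl_comm]
    refine Subset.antisymm (fun z hz => ?_) (fun z hz => ⟨hx.1 hz, hy.1 hz⟩)
    intro hzW
    obtain ⟨s, t, -, hst, hzst⟩ := hbig z hzW
    exact hzst ⟨(hx.2 fun w hw => (hst hw).1).trans hz.1, hz.2.trans (hy.2 fun w hw => (hst hw).2)⟩
  · have hform : ∀ U ∈ 𝒰, (∃ x y, x < y ∧ U = Ioo x y) ∨ ∃ x, U = Ioi x := by
      intro U hU'
      have hb : ⊥ ∉ U := fun h => hbot ⟨U, hU', h⟩
      obtain ⟨x, y, hxy, hc | hc⟩ := isOpenInterval_sepOf.1 (hU U hU').1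
      · exact Or.inl ⟨x, y, hxy, hc⟩
      · rw [hc] at hb
        exact Or.inr ⟨y, hc.trans (Icc_compl_eq_Ioi hb)⟩
    have hWne : W.Nonempty := by
      obtain ⟨U, hU'⟩ := hne
      rcases hform U hU' with ⟨x, y, hxy, hc⟩ | ⟨x, hc⟩
      · obtain ⟨z, hz⟩ := exists_between hxy
        exact ⟨z, U, hU', by rw [hc]; exact hz⟩
      · obtain ⟨z, hz⟩ := exists_gt x
        exact ⟨z, U, hU', by rw [hc]; exact hz⟩
    have hconvU : ∀ U ∈ 𝒰, U.OrdConnected := by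
      intro U hU'
      rcases hform U hU' with ⟨x, y, hxy, hc⟩ | ⟨x, hc⟩
      · rw [hc]; exact ordConnected_Ioo
      · rw [hc]; exact ordConnected_Ioi
    have hconv : W.OrdConnected := by
      refine ⟨?_⟩
      rintro s ⟨U, hU', hs⟩ t ⟨V, hV, ht⟩ z hz
      rcases hchain.total hU' hV with hUV | hUV
      · exact ⟨V, hV, (hconvU V hV).out (hUV hs) ht hz⟩
      · exact ⟨U, hU', (hconvU U hU').out hs (hUV ht) hz⟩
    have hmin : ∀ x ∈ W, ∃ y ∈ W, y < x := by
      rintro w ⟨U, hU', hw⟩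
      rcases hform U hU' with ⟨x, y, hxy, hc⟩ | ⟨x, hc⟩
      · rw [hc] at hw
        obtain ⟨z, hz⟩ := exists_between hw.1
        exact ⟨z, ⟨U, hU', by rw [hc]; exact ⟨hz.1, hz.2.trans hw.2⟩⟩, hz.2⟩
      · rw [hc] at hw
        obtain ⟨z, hz⟩ := exists_between hw
        exact ⟨z, ⟨U, hU', by rw [hc]; exact hz.1⟩, hz.2⟩
    have hmax : ∀ x ∈ W, ∃ y ∈ W, x < y := by
      rintro w ⟨U, hU', hw⟩
      rcases hform U hU' with ⟨x, y, hxy, hc⟩ | ⟨x, hc⟩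
      · rw [hc] at hw
        obtain ⟨z, hz⟩ := exists_between hw.2
        exact ⟨z, ⟨U, hU', by rw [hc]; exact ⟨hw.1.trans hz.1, hz.2⟩⟩, hz.1⟩
      · rw [hc] at hw
        obtain ⟨z, hz⟩ := exists_gt w
        exact ⟨z, ⟨U, hU', by rw [hc]; exact hw.trans hz⟩, hz⟩
    rcases eq_Ioo_or_eq_Ioi h hWne hconv hmin hmax with ⟨x, y, hxy, hc⟩ | ⟨x, hc⟩
    · exact ⟨x, y, hxy, Or.inl hc⟩
    -- `Ioi ⊥` misses only one point, whereas `W ⊆ I` misses two.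
    · have hx : ⊥ < x := by
        rw [bot_lt_iff_ne_bot]
        rintro rfl
        have hIio : ∀ z, z ∉ I → z = ⊥ := fun z hz => by
          by_contra hne
          exact hz (hWI (by rw [hc]; exact bot_lt_iff_ne_bot.2 hne))
        obtain ⟨a, b, hab, hI' | hI'⟩ := isOpenInterval_sepOf.1 hI
        · exact (bot_le.trans_lt hab).ne' (hIio b (by rw [hI']; exact fun h => h.2.false))
        · exact (bot_le.trans_lt hab).ne' (hIio b (by
            rw [hI']; exact fun h => h (right_mem_Icc.2 hab.le)))
      refine ⟨⊥, x, hx, Or.inr ?_⟩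
      rw [hc]
      exact (Icc_compl_eq_Ioi fun h => h (left_mem_Icc.2 hx.le)).symm

end Intervals

/-- Dense order-complete separation relations are those of complete rays. -/
theorem exists_linearOrder_of_mem_Sepa {R : ChordRel X} (hR : R ∈ Sepa X) (p : X) :
    ∃ (_ : LinearOrder X) (_ : OrderBot X), (⊥ : X) = p ∧ DenselyOrdered X ∧ NoMaxOrder X ∧
      HasSups X ∧ R = sepOf X := by
  obtain ⟨h1, h2, h3⟩ := hR
  obtain ⟨o, b, hb, hd, hm, rfl⟩ := h1.exists_linearOrder h2 p
  exact ⟨o, b, hb, hd, hm, hasSups_of_isOrderComplete h3, rfl⟩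

theorem sepOf_mem_Sepa [LinearOrder X] [OrderBot X] [DenselyOrdered X] [NoMaxOrder X]
    (h : HasSups X) : sepOf X ∈ Sepa X := by
  obtain ⟨x, hx⟩ := exists_gt (⊥ : X)
  have : Nontrivial X := ⟨⊥, x, hx.ne⟩
  exact ⟨isSeparation_sepOf, isDense_sepOf, isOrderComplete_sepOf h⟩

/-! ### Components -/

section Component

variable {𝒞 : Set (Set X)} {Y Z : Set X} {x y z : X}

theorem component_subset : component 𝒞 Y y ⊆ Y := sUnion_subset fun _ hZ => hZ.2.2

theorem subset_component (hZ : Z ∈ 𝒞) (hy : y ∈ Z) (hZY : Z ⊆ Y) : Z ⊆ component 𝒞 Y y :=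
  subset_sUnion_of_mem ⟨hZ, hy, hZY⟩

/-- The union of a family of members with a common point is a member. -/
def UnionClosed (𝒞 : Set (Set X)) : Prop :=
  ∀ C : Set (Set X), C ⊆ 𝒞 → (⋂₀ C).Nonempty → ⋃₀ C ∈ 𝒞

theorem UnionClosed.component_mem (h : UnionClosed 𝒞) : component 𝒞 Y y ∈ 𝒞 :=
  h _ (fun _ hZ => hZ.1) ⟨y, fun _ hZ => hZ.2.1⟩

theorem UnionClosed.union_mem (h : UnionClosed 𝒞) (hY : Y ∈ 𝒞) (hZ : Z ∈ 𝒞) (hy : y ∈ Y)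
    (hz : y ∈ Z) : Y ∪ Z ∈ 𝒞 := by
  rw [← sUnion_pair]
  refine h _ ?_ ⟨y, ?_⟩
  · rintro _ (rfl | rfl)
    exacts [hY, hZ]
  · rintro _ (rfl | rfl)
    exacts [hy, hz]

theorem UnionClosed.subset_component_of_mem (h : UnionClosed 𝒞) (hZ : Z ∈ 𝒞)
    (hzZ : z ∈ Z) (hz : z ∈ component 𝒞 Y y) (hZY : Z ⊆ Y) : Z ⊆ component 𝒞 Y y := by
  obtain ⟨W, ⟨hW, hy, hWY⟩, hzW⟩ := hz
  exact subset_union_right.trans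
    (subset_component (h.union_mem hW hZ hzW hzZ) (Or.inl hy) (union_subset hWY hZY))

theorem UnionClosed.component_eq_of_mem (h : UnionClosed 𝒞) (hz : z ∈ component 𝒞 Y y) :
    component 𝒞 Y z = component 𝒞 Y y := by
  apply Subset.antisymm
  · rintro w ⟨Z, ⟨hZ, h1, h2⟩, hw⟩
    exact h.subset_component_of_mem hZ h1 hz h2 hw
  · exact subset_component h.component_mem hz component_subset

end Component

/-! ### Arc-convex sets -/

section ArcConvex

variable {R : ChordRel X} {S : Set X}

theorem singleton_mem_arcConvex (x : X) : {x} ∈ arcConvex R := by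
  rintro a b c d h rfl hd
  exact (h.ne_right hd.symm).elim

/-- If a chord separates `c` from `d`, it separates one of them from the common point `e`, unless it
passes through `e`. So it already meets one member of the family. -/
theorem IsSeparation.unionClosed_arcConvex (hR : IsSeparation R) : UnionClosed (arcConvex R) := by
  rintro C hC ⟨e, he⟩ a b c d h ⟨S, hS, hc⟩ ⟨T, hT, hd⟩
  by_contra! hab
  have ha : e ≠ a := by rintro rfl; exact hab.1 ⟨S, hS, he S hS⟩
  have hb : e ≠ b := by rintro rfl; exact hab.2 ⟨S, hS, he S hS⟩
  rcases hR.cross_or h ha hb with h' | h'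
  · rcases hC hS a b c e h' hc (he S hS) with h'' | h''
    exacts [hab.1 ⟨S, hS, h''⟩, hab.2 ⟨S, hS, h''⟩]
  · rcases hC hT a b e d h' (he T hT) hd with h'' | h''
    exacts [hab.1 ⟨T, hT, h''⟩, hab.2 ⟨T, hT, h''⟩]

/-- Symmetry of `R` exchanges the chord inside the set with the chord outside it. Passing to the
complement allows cutting at a point of the set instead of one outside it. -/
theorem IsSeparation.compl_mem_arcConvex (hR : IsSeparation R) (hS : S ∈ arcConvex R) :
    Sᶜ ∈ arcConvex R := by
  intro a b c d h hc hd
  by_contra! hab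
  simp only [mem_compl_iff, not_not] at hab
  rcases hS c d a b (hR.cross_symm.1 h) hab.1 hab.2 with h' | h'
  exacts [hc h', hd h']

theorem mem_arcConvex_of_ordConnected [LinearOrder X] (hS : S.OrdConnected) :
    S ∈ arcConvex (sepOf X) := by
  have key : ∀ a b c d, Interlaced a b c d → c ∈ S → d ∈ S → c < d → a ∈ S ∨ b ∈ S := by
    intro a b c d h hc hd hcd
    rcases (interlaced_of_lt hcd).1 h.symm with h1 | h1
    · exact Or.inl (hS.out hc hd ⟨h1.1.1.le, h1.1.2.le⟩)
    · exact Or.inr (hS.out hc hd ⟨h1.2.1.le, h1.2.2.le⟩)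
  intro a b c d h hc hd
  rcases h.ne_right.lt_or_gt with hcd | hcd
  · exact key a b c d (cross_sepOf.1 h) hc hd hcd
  · exact key a b d c (cross_sepOf.1 (cross_comm_right.1 h)) hd hc hcd

/-- A missing point `z` between `s` and `t` would make `{⊥, z}` a chord disjoint from `S` that
separates `s` from `t`. -/
theorem ordConnected_of_mem_arcConvex [LinearOrder X] [OrderBot X] (hS : S ∈ arcConvex (sepOf X))
    (hb : ⊥ ∉ S) : S.OrdConnected := by
  refine ⟨?_⟩
  intro s hs t ht z hz
  by_contra hzS
  have hsz : s < z := hz.1.lt_of_ne (by rintro rfl; exact hzS hs)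
  have hzt : z < t := hz.2.lt_of_ne (by rintro rfl; exact hzS ht)
  have hbs : ⊥ < s := bot_lt_iff_ne_bot.2 (by rintro rfl; exact hb hs)
  have : Interlaced ⊥ z s t :=
    (interlaced_of_lt (hbs.trans hsz)).2 (Or.inl ⟨⟨hbs, hsz⟩, fun h => h.2.not_gt hzt⟩)
  rcases hS _ _ _ _ (cross_sepOf.2 this) hs ht with h | h
  exacts [hb h, hzS h]

theorem ordConnected_union_glb [LinearOrder X] {x : X} (hS : S.OrdConnected) (hx : IsGLB S x) :
    (S ∪ {x}).OrdConnected := by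
  have key : ∀ t ∈ S, ∀ z, x ≤ z → z ≤ t → z ∈ S ∪ {x} := by
    intro t ht z h1 h2
    rcases h1.eq_or_lt with rfl | h1
    · exact Or.inr rfl
    have : ∃ s ∈ S, s < z := by
      by_contra! hcon
      exact h1.not_ge (hx.2 hcon)
    obtain ⟨s, hs, hsz⟩ := this
    exact Or.inl (hS.out hs ht ⟨hsz.le, h2⟩)
  refine ⟨?_⟩
  rintro s hs t (ht | rfl) z ⟨h1, h2⟩
  · refine key t ht z (le_trans ?_ h1) h2
    rcases hs with hs | rfl
    exacts [hx.1 hs, le_rfl]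
  · refine Or.inr (h2.antisymm (le_trans ?_ h1))
    rcases hs with hs | rfl
    exacts [hx.1 hs, le_rfl]

theorem ordConnected_diff_glb [LinearOrder X] {x : X} (hS : S.OrdConnected) (hx : IsGLB S x) :
    (S \ {x}).OrdConnected := by
  refine ⟨?_⟩
  rintro s ⟨hs, hsx⟩ t ⟨ht, -⟩ z hz
  refine ⟨hS.out hs ht hz, ?_⟩
  rintro rfl
  exact hsx (hz.1.antisymm (hx.1 hs))

/-- Disjoint convex sets are ordered one entirely before the other. The button is the infimum of the
later set, which belongs to the convex union. -/
theorem exists_button [LinearOrder X] [OrderBot X] (h : HasSups X) {A B : Set X}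
    (hA : A.OrdConnected) (hB : B.OrdConnected) (hAB : (A ∪ B).OrdConnected) (hdisj : Disjoint A B)
    {a b : X} (ha : a ∈ A) (hb : b ∈ B) (hlt : a < b) :
    ∃ x ∈ A ∪ B, (A ∪ {x}).OrdConnected ∧ (B ∪ {x}).OrdConnected := by
  have hne : ∀ {z}, z ∈ A → z ∈ B → False := fun h1 h2 => disjoint_left.1 hdisj h1 h2
  have hle : ∀ s ∈ A, ∀ t ∈ B, s ≤ t := by
    intro s hs t ht
    by_contra! hts
    rcases le_or_gt a t with h1 | h1
    · exact hne (hA.out ha hs ⟨h1, hts.le⟩) ht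
    · exact hne ha (hB.out ht hb ⟨h1.le, hlt.le⟩)
  obtain ⟨x, hx⟩ := h.exists_isGLB ⟨b, hb⟩
  have hAx : ∀ s ∈ A, s ≤ x := fun s hs => hx.2 fun t ht => hle s hs t ht
  have hxAB : x ∈ A ∪ B := hAB.out (Or.inl ha) (Or.inr hb) ⟨hAx a ha, hx.1 hb⟩
  refine ⟨x, hxAB, ⟨?_⟩, ordConnected_union_glb hB hx⟩
  rintro s hs t ht z ⟨h1, h2⟩
  have hzx : z ≤ x := h2.trans (by rcases ht with ht | rfl; exacts [hAx t ht, le_rfl])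
  rcases hs with hs | rfl
  · rcases hAB.out (Or.inl hs) hxAB ⟨h1, hzx⟩ with hz | hz
    · exact Or.inl hz
    · exact Or.inr (hzx.antisymm (hx.1 hz))
  · exact Or.inr (hzx.antisymm h1)

/-- Cut at `x`, so that both `Yᶜ` and the component `K` avoid the base point and are order-convex.
Their union is again convex: a point of `Y` between a point of `Yᶜ` and a point of `K` is joined to
`K` by a segment inside `Y`, hence lies in `K`. The set wanted is the complement of this union. -/
theorem diff_component_mem_arcConvex (hR : R ∈ Sepa X) {Y : Set X} (hY : Y ∈ arcConvex R) {x : X}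
    (hx : x ∈ Y) (y : X) :
    Y \ component (arcConvex R) (Y \ {x}) y ∈ arcConvex R := by
  obtain ⟨o, bt, rfl, hd, hm, hs, rfl⟩ := exists_linearOrder_of_mem_Sepa hR x
  have hsep := isSeparation_sepOf (X := X)
  have hU := hsep.unionClosed_arcConvex
  set K := component (arcConvex (sepOf X)) (Y \ {⊥}) y with hK
  have hKY : K ⊆ Y \ {⊥} := component_subset
  have hKc : K.OrdConnected := ordConnected_of_mem_arcConvex hU.component_mem fun h => (hKY h).2 rfl
  have hYc : Yᶜ.OrdConnected :=
    ordConnected_of_mem_arcConvex (hsep.compl_mem_arcConvex hY) fun h => h hx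
  have hKext : ∀ {s t r}, r ∈ Icc s t → r ∈ K → Icc s t ⊆ Y → ⊥ ∉ Icc s t → Icc s t ⊆ K := by
    intro s t r h1 h2 h3 h4
    exact hU.subset_component_of_mem (mem_arcConvex_of_ordConnected ordConnected_Icc) h1 h2
      fun w hw => ⟨h3 hw, fun h => h4 (by rw [← mem_singleton_iff.1 h]; exact hw)⟩
  have hconv : (Yᶜ ∪ K).OrdConnected := by
    refine ⟨?_⟩
    rintro s hs t ht z ⟨h1, h2⟩
    by_contra hz
    simp only [mem_union, mem_compl_iff, not_or, not_not] at hz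
    obtain ⟨hzY, hzK⟩ := hz
    have hbz : ⊥ ≠ s := by
      rintro rfl
      rcases hs with hs | hs
      exacts [hs hx, (hKY hs).2 rfl]
    rcases hs with hs | hs <;> rcases ht with ht | ht
    · exact hYc.out hs ht ⟨h1, h2⟩ hzY
    · refine hzK (hKext (right_mem_Icc.2 h2) ht (fun w hw => ?_) (fun h => ?_) (left_mem_Icc.2 h2))
      · by_contra hwY
        exact hYc.out hs hwY ⟨h1, hw.1⟩ hzY
      · exact hbz ((le_bot_iff.1 (h1.trans h.1)).symm)
    · refine hzK (hKext (left_mem_Icc.2 h1) hs (fun w hw => ?_) (fun h => ?_) (right_mem_Icc.2 h1))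
      · by_contra hwY
        exact hYc.out hwY ht ⟨hw.2, h2⟩ hzY
      · exact hbz ((le_bot_iff.1 h.1).symm)
    · exact hzK (hKc.out hs ht ⟨h1, h2⟩)
  have := hsep.compl_mem_arcConvex (mem_arcConvex_of_ordConnected hconv)
  rwa [compl_union, compl_compl, ← sdiff_eq] at this

/-- Here the first alternative of (C4) always holds. For disjoint sets that do not cover `X`, cut
outside their union and use `exists_button`. If they cover `X`, cut at a point of `A` and take the
infimum `x` of `B`; then `A ∪ {x}` is the complement of the convex set `B \ {x}`. -/
theorem button_arcConvex (hR : R ∈ Sepa X) {A B : Set X} (hA : A ∈ arcConvex R)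
    (hB : B ∈ arcConvex R) (hA' : A.Nonempty) (hB' : B.Nonempty) (hAB : A ∪ B ∈ arcConvex R) :
    ∃ x ∈ A ∪ B, A ∪ {x} ∈ arcConvex R ∧ B ∪ {x} ∈ arcConvex R := by
  obtain ⟨a, ha⟩ := hA'
  obtain ⟨b, hb⟩ := hB'
  by_cases hdisj : Disjoint A B
  swap
  · obtain ⟨x, hxA, hxB⟩ := not_disjoint_iff.1 hdisj
    refine ⟨x, Or.inl hxA, ?_, ?_⟩
    · rwa [union_eq_self_of_subset_right (singleton_subset_iff.2 hxA)]
    · rwa [union_eq_self_of_subset_right (singleton_subset_iff.2 hxB)]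
  by_cases huniv : A ∪ B = univ
  · obtain ⟨o, bt, rfl, hd, hm, hs, rfl⟩ := exists_linearOrder_of_mem_Sepa hR a
    have hBc := ordConnected_of_mem_arcConvex hB (disjoint_left.1 hdisj ha)
    obtain ⟨x, hx⟩ := hs.exists_isGLB ⟨b, hb⟩
    have hcompl : A = Bᶜ := by
      rw [eq_compl_iff_isCompl]
      exact ⟨hdisj, codisjoint_iff.2 huniv⟩
    refine ⟨x, huniv ▸ mem_univ x, ?_, mem_arcConvex_of_ordConnected (ordConnected_union_glb hBc hx)⟩
    have := isSeparation_sepOf.compl_mem_arcConvex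
      (mem_arcConvex_of_ordConnected (ordConnected_diff_glb hBc hx))
    rwa [compl_sdiff, ← hcompl, union_comm] at this
  · obtain ⟨p, hp⟩ := (ne_univ_iff_exists_notMem _).1 huniv
    obtain ⟨o, bt, rfl, hd, hm, hs, rfl⟩ := exists_linearOrder_of_mem_Sepa hR p
    have hAc := ordConnected_of_mem_arcConvex hA fun h => hp (Or.inl h)
    have hBc := ordConnected_of_mem_arcConvex hB fun h => hp (Or.inr h)
    have hABc := ordConnected_of_mem_arcConvex hAB hp
    have hne : a ≠ b := by rintro rfl; exact disjoint_left.1 hdisj ha hb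
    rcases hne.lt_or_gt with h | h
    · obtain ⟨x, hx, h1, h2⟩ := exists_button hs hAc hBc hABc hdisj ha hb h
      exact ⟨x, hx, mem_arcConvex_of_ordConnected h1, mem_arcConvex_of_ordConnected h2⟩
    · rw [union_comm] at hABc
      obtain ⟨x, hx, h1, h2⟩ := exists_button hs hBc hAc hABc hdisj.symm hb ha h
      exact ⟨x, hx.symm, mem_arcConvex_of_ordConnected h2, mem_arcConvex_of_ordConnected h1⟩

theorem exists_cross (hR : IsDense R) {a b : X} (hab : a ≠ b) : ∃ c d, Cross R a b c d := by
  obtain ⟨⟨⟨c, d⟩, hl⟩, h⟩ := hR.2 ⟨s(a, b), by rwa [Sym2.mk_isDiag_iff]⟩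
  exact ⟨c, d, _, _, rfl, rfl, h⟩

theorem isFlimsy_arcConvex (hR : R ∈ Sepa X) : IsFlimsy 2 (arcConvex R) where
  lt_card := by
    obtain ⟨p, -⟩ := hR.2.1.1.exists_pair_ne
    obtain ⟨o, bt, -, hd, hm, -⟩ := exists_linearOrder_of_mem_Sepa hR p
    have : Infinite X := NoMaxOrder.infinite
    rw [ENat.card_eq_top_of_infinite]
    exact ENat.natCast_lt_top 2
  compl_mem S hS := by
    have hS' : S.Subsingleton := by
      rw [← encard_le_one_iff_subsingleton]
      exact Order.le_of_lt_add_one (by simpa [one_add_one_eq_two] using hS)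
    intro a b c d h _ _
    by_contra! hab
    simp only [mem_compl_iff, not_not] at hab
    exact h.ne_left (hS' hab.1 hab.2)
  compl_notMem S hS := by
    obtain ⟨a, b, hab, rfl⟩ := encard_eq_two.1 hS
    intro hmem
    obtain ⟨c, d, h⟩ := exists_cross hR.2.1 hab
    obtain ⟨-, h1, h2, h3, h4, -⟩ := hR.1.distinct h
    rcases hmem a b c d h (by simp [h1.symm, h3.symm]) (by simp [h2.symm, h4.symm]) with h | h <;>
      simp at h

theorem arcConvex_mem_Conn (hR : R ∈ Sepa X) : arcConvex R ∈ Conn X :=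
  ⟨{ singleton_mem := singleton_mem_arcConvex
     sUnion_mem := hR.1.unionClosed_arcConvex
     diff_component_mem := fun _ hY _ hx y _ => diff_component_mem_arcConvex hR hY hx y
     button_or_seam := fun _ hA _ hB hA' hB' hAB =>
      Or.inl (button_arcConvex hR hA hB hA' hB' hAB) },
    isFlimsy_arcConvex hR⟩

end ArcConvex

/-! ### Recovering a separation relation from its arc-convex sets -/

section Phi

variable {𝒞 : Set (Set X)} {a b c d : X}

theorem cross_Phi : Cross (Phi 𝒞) a b c d ↔
    a ≠ b ∧ a ≠ c ∧ a ≠ d ∧ b ≠ c ∧ b ≠ d ∧ c ≠ d ∧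
    component 𝒞 ({a, b} : Set X)ᶜ c ≠ component 𝒞 ({a, b} : Set X)ᶜ d := by
  refine cross_ofQuad (P := fun a b c d => a ≠ b ∧ a ≠ c ∧ a ≠ d ∧ b ≠ c ∧ b ≠ d ∧ c ≠ d ∧
    component 𝒞 ({a, b} : Set X)ᶜ c ≠ component 𝒞 ({a, b} : Set X)ᶜ d) ?_ ?_ ?_
  · rintro a b c d ⟨h1, h2, h3, h4, h5, h6, h7⟩
    refine ⟨h1.symm, h4, h5, h2, h3, h6, ?_⟩
    rwa [pair_comm b a]
  · rintro a b c d ⟨h1, h2, h3, h4, h5, h6, h7⟩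
    exact ⟨h1, h3, h2, h5, h4, h6.symm, h7.symm⟩
  · rintro a b c d ⟨h1, h2, h3, h4, h5, h6, h7⟩
    exact ⟨h1, h6⟩

/-- This form lets a crossing be refuted by exhibiting one connected set. The points `c` and `d`
need not be assumed distinct, since `{c}` is such a test set. -/
theorem cross_Phi_iff_of_ne (hC : UnionClosed 𝒞) (hs : ∀ x, {x} ∈ 𝒞) (hab : a ≠ b) (hac : a ≠ c)
    (had : a ≠ d) (hbc : b ≠ c) (hbd : b ≠ d) : Cross (Phi 𝒞) a b c d ↔
      ∀ Z ∈ 𝒞, c ∈ Z → d ∈ Z → a ∈ Z ∨ b ∈ Z := by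
  rw [cross_Phi]
  constructor
  · rintro ⟨-, -, -, -, -, -, h⟩ Z hZ hc hd
    by_contra! hcon
    have hZ' : Z ⊆ ({a, b} : Set X)ᶜ := by
      rintro z hz (rfl | rfl)
      exacts [hcon.1 hz, hcon.2 hz]
    exact h (hC.component_eq_of_mem (subset_component hZ hd hZ' hc))
  · intro h
    refine ⟨hab, hac, had, hbc, hbd, ?_, fun heq => ?_⟩
    · rintro rfl
      rcases h {c} (hs c) rfl rfl with h | h
      exacts [hac h, hbc h]
    · have : d ∈ component 𝒞 ({a, b} : Set X)ᶜ c := by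
        rw [heq]
        exact subset_component (hs d) rfl (by
          rintro _ rfl
          simp [had.symm, hbd.symm]) rfl
      obtain ⟨Z, ⟨hZ, hc, hZ'⟩, hd⟩ := this
      rcases h Z hZ hc hd with h | h
      exacts [hZ' h (Or.inl rfl), hZ' h (Or.inr rfl)]

/-- Cut at `a`. The test sets `Ioo ⊥ b` and `Ioi b`, the two sides of the chord, force `c` and `d`
onto different sides. -/
theorem Phi_arcConvex {R : ChordRel X} (hR : R ∈ Sepa X) : Phi (arcConvex R) = R := by
  apply chordRel_ext
  intro a b c d
  obtain ⟨o, bt, rfl, hd, hm, -, rfl⟩ := exists_linearOrder_of_mem_Sepa hR a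
  by_cases hne : ⊥ ≠ b ∧ ⊥ ≠ c ∧ ⊥ ≠ d ∧ b ≠ c ∧ b ≠ d
  swap
  · rw [cross_Phi]
    refine ⟨fun h => (hne ?_).elim, fun h => (hne ?_).elim⟩
    · exact ⟨h.1, h.2.1, h.2.2.1, h.2.2.2.1, h.2.2.2.2.1⟩
    · have := isSeparation_sepOf.distinct h
      exact ⟨this.1, this.2.1, this.2.2.1, this.2.2.2.1, this.2.2.2.2.1⟩
  obtain ⟨h1, h2, h3, h4, h5⟩ := hne
  rw [cross_Phi_iff_of_ne isSeparation_sepOf.unionClosed_arcConvex singleton_mem_arcConvex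
    h1 h2 h3 h4 h5]
  refine ⟨fun h => ?_, fun h Z hZ hc hd => hZ _ _ _ _ h hc hd⟩
  have hb := bot_lt_iff_ne_bot.2 h1.symm
  have hc := bot_lt_iff_ne_bot.2 h2.symm
  have hd := bot_lt_iff_ne_bot.2 h3.symm
  rw [cross_sepOf, interlaced_of_lt hb]
  have hIoo := h _ (mem_arcConvex_of_ordConnected (ordConnected_Ioo (a := ⊥) (b := b)))
  have hIoi := h _ (mem_arcConvex_of_ordConnected (ordConnected_Ioi (a := b)))
  simp only [mem_Ioo, mem_Ioi, lt_self_iff_false, false_and, and_false, or_self, hc, hd, true_and,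
    hb.not_gt, imp_false, mem_compl_iff, mem_Icc, bot_le, not_le, not_lt] at hIoo hIoi ⊢
  rcases h4.lt_or_gt with h6 | h6
  · exact Or.inr ⟨h6, (hIoi h6).lt_of_ne h5.symm⟩
  · exact Or.inl ⟨h6, (hIoo h6).lt_of_ne h5⟩

end Phi

/-! ### The separation relation of a 2-flimsy connectivity -/

section Conn

variable {𝒞 : Set (Set X)} {Y Y' Z : Set X} {a b c d e x y : X}

theorem component_mono (h : Y' ⊆ Y) : component 𝒞 Y' y ⊆ component 𝒞 Y y :=
  sUnion_subset_sUnion fun _ hZ => ⟨hZ.1, hZ.2.1, hZ.2.2.trans h⟩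

theorem IsConnectivity.unionClosed (h : IsConnectivity 𝒞) : UnionClosed 𝒞 := h.sUnion_mem

theorem IsConnectivity.empty_mem (h : IsConnectivity 𝒞) (x : X) : ∅ ∈ 𝒞 := by
  have := h.sUnion_mem ∅ (empty_subset _) ⟨x, by simp⟩
  rwa [sUnion_empty] at this

theorem IsConnectivity.self_mem_component (h : IsConnectivity 𝒞) (hy : y ∈ Y) :
    y ∈ component 𝒞 Y y :=
  subset_component (h.singleton_mem y) rfl (singleton_subset_iff.2 hy) rfl

/-- A component of `Y \ {x}` can be removed from any connected subset of `Y` containing it and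
`x`. -/
theorem IsConnectivity.diff_mem_of_subset (h : IsConnectivity 𝒞) (hY' : Y' ∈ 𝒞) (hYY : Y' ⊆ Y)
    (hx : x ∈ Y') (hy : y ∈ Y \ {x}) (hK : component 𝒞 (Y \ {x}) y ⊆ Y') :
    Y' \ component 𝒞 (Y \ {x}) y ∈ 𝒞 := by
  have hyK := h.self_mem_component hy
  have : component 𝒞 (Y' \ {x}) y = component 𝒞 (Y \ {x}) y := by
    apply Subset.antisymm (component_mono (sdiff_subset_sdiff_left hYY))
    exact subset_component h.unionClosed.component_mem hyK
      fun z hz => ⟨hK hz, (component_subset hz).2⟩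
  rw [← this]
  exact h.diff_component_mem Y' hY' x hx y (hK hyK)

theorem compl_singleton_diff (a b : X) : ({a} : Set X)ᶜ \ {b} = {a, b}ᶜ := by
  ext z; simp

variable (h𝒞 : 𝒞 ∈ Conn X)

include h𝒞

theorem compl_singleton_mem (a : X) : ({a} : Set X)ᶜ ∈ 𝒞 :=
  h𝒞.2.compl_mem _ (by rw [encard_singleton]; norm_num)

theorem compl_pair_notMem (hab : a ≠ b) : ({a, b} : Set X)ᶜ ∉ 𝒞 :=
  h𝒞.2.compl_notMem _ (by rw [encard_pair hab]; norm_num)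

theorem exists_ne_ne (hab : a ≠ b) : ∃ c, c ≠ a ∧ c ≠ b := by
  by_contra! hcon
  have : ({a, b} : Set X)ᶜ = ∅ := by
    rw [eq_empty_iff_forall_notMem]
    intro z hz
    apply hz
    by_cases hza : z = a
    exacts [Or.inl hza, Or.inr (hcon z hza)]
  exact compl_pair_notMem h𝒞 hab (this ▸ h𝒞.1.empty_mem a)

theorem exists_notMem_component (hab : a ≠ b) (y : X) :
    ∃ v ∈ ({a, b} : Set X)ᶜ, v ∉ component 𝒞 ({a, b} : Set X)ᶜ y := by
  by_contra! hcon
  have : component 𝒞 ({a, b} : Set X)ᶜ y = {a, b}ᶜ := component_subset.antisymm hcon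
  exact compl_pair_notMem h𝒞 hab (this ▸ h𝒞.1.unionClosed.component_mem)

theorem compl_diff_component_mem (hab : a ≠ b) (hy : y ∈ ({a, b} : Set X)ᶜ) :
    ({a} : Set X)ᶜ \ component 𝒞 ({a, b} : Set X)ᶜ y ∈ 𝒞 := by
  have := h𝒞.1.diff_component_mem _ (compl_singleton_mem h𝒞 a) b hab.symm y
    (fun h => hy (Or.inl h))
  rwa [compl_singleton_diff] at this

theorem compl_diff_component_mem' (hab : a ≠ b) (hy : y ∈ ({a, b} : Set X)ᶜ) :
    ({b} : Set X)ᶜ \ component 𝒞 ({a, b} : Set X)ᶜ y ∈ 𝒞 := by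
  rw [pair_comm a b] at hy ⊢
  exact compl_diff_component_mem h𝒞 hab.symm hy

theorem disjoint_component (ha : component 𝒞 Y a ≠ component 𝒞 Y b) :
    Disjoint (component 𝒞 Y a) (component 𝒞 Y b) := by
  rw [disjoint_left]
  intro z h1 h2
  exact ha ((h𝒞.1.unionClosed.component_eq_of_mem h1).symm.trans
    (h𝒞.1.unionClosed.component_eq_of_mem h2))

theorem component_ne_of_notMem (hb : b ∈ Y) (h : b ∉ component 𝒞 Y a) :
    component 𝒞 Y a ≠ component 𝒞 Y b := fun heq =>
  h (heq ▸ h𝒞.1.self_mem_component hb)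

theorem compl_diff_two_components_mem (hab : a ≠ b) (hc : c ∈ ({a, b} : Set X)ᶜ)
    (hd : d ∈ ({a, b} : Set X)ᶜ)
    (hcd : component 𝒞 ({a, b} : Set X)ᶜ c ≠ component 𝒞 ({a, b} : Set X)ᶜ d) :
    (({a} : Set X)ᶜ \ component 𝒞 ({a, b} : Set X)ᶜ c) \ component 𝒞 ({a, b} : Set X)ᶜ d ∈ 𝒞 := by
  have h1 := compl_diff_component_mem h𝒞 hab hc
  have hdisj := disjoint_component h𝒞 hcd
  have := h𝒞.1.diff_mem_of_subset (Y := {a}ᶜ) (x := b) (y := d) h1 sdiff_subset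
    ⟨hab.symm, fun h => component_subset h (Or.inr rfl)⟩
    (by rwa [compl_singleton_diff])
    (by
      rw [compl_singleton_diff]
      exact fun z hz => ⟨fun h => component_subset hz (Or.inl h), disjoint_right.1 hdisj hz⟩)
  rwa [compl_singleton_diff] at this

/-- The complement of a pair of points has at most two components. -/
theorem component_eq_or (hab : a ≠ b) (hc : c ∈ ({a, b} : Set X)ᶜ) (hd : d ∈ ({a, b} : Set X)ᶜ)
    (he : e ∈ ({a, b} : Set X)ᶜ) :
    component 𝒞 ({a, b} : Set X)ᶜ c = component 𝒞 ({a, b} : Set X)ᶜ d ∨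
    component 𝒞 ({a, b} : Set X)ᶜ c = component 𝒞 ({a, b} : Set X)ᶜ e ∨
    component 𝒞 ({a, b} : Set X)ᶜ d = component 𝒞 ({a, b} : Set X)ᶜ e := by
  by_contra! hcon
  obtain ⟨hcd, hce, hde⟩ := hcon
  have hU := h𝒞.1.unionClosed
  have hT1 := compl_diff_two_components_mem h𝒞 hab hc hd hcd
  have hT2 : (({b} : Set X)ᶜ \ component 𝒞 ({a, b} : Set X)ᶜ c) \
      component 𝒞 ({a, b} : Set X)ᶜ d ∈ 𝒞 := by
    rw [pair_comm a b] at hc hd hcd ⊢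
    exact compl_diff_two_components_mem h𝒞 hab.symm hc hd hcd
  have hcc := h𝒞.1.self_mem_component hc
  have hdd := h𝒞.1.self_mem_component hd
  have hee := h𝒞.1.self_mem_component he
  have d1 := disjoint_component h𝒞 hcd
  have d2 := disjoint_component h𝒞 hce
  have d3 := disjoint_component h𝒞 hde
  have hcd' : c ≠ d := by rintro rfl; exact hcd rfl
  have ac : a ∉ component 𝒞 ({a, b} : Set X)ᶜ c := fun h => component_subset h (Or.inl rfl)
  have ad : a ∉ component 𝒞 ({a, b} : Set X)ᶜ d := fun h => component_subset h (Or.inl rfl)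
  have bc : b ∉ component 𝒞 ({a, b} : Set X)ᶜ c := fun h => component_subset h (Or.inr rfl)
  have bd : b ∉ component 𝒞 ({a, b} : Set X)ᶜ d := fun h => component_subset h (Or.inr rfl)
  have ec := disjoint_right.1 d2 hee
  have ed := disjoint_right.1 d3 hee
  -- Given three components, the complement of those of `c` and `d` is connected: it is glued at `e`
  -- from its parts without `a` and without `b`. Hence `a` and `b` lie in one component `W` of `{c,
  -- d}ᶜ`.
  have hT := hU.union_mem (y := e) hT1 hT2 ⟨⟨fun h => he (Or.inl h), ec⟩, ed⟩
    ⟨⟨fun h => he (Or.inr h), ec⟩, ed⟩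
  have hTsub : ∀ z, z ∉ component 𝒞 ({a, b} : Set X)ᶜ c → z ∉ component 𝒞 ({a, b} : Set X)ᶜ d →
      z ∈ component 𝒞 ({c, d} : Set X)ᶜ a := by
    intro z hz1 hz2
    refine subset_component hT (Or.inr ⟨⟨hab, ac⟩, ad⟩) ?_ ?_
    · rintro w (⟨⟨-, hw1⟩, hw2⟩ | ⟨⟨-, hw1⟩, hw2⟩) (rfl | rfl)
      exacts [hw1 hcc, hw2 hdd, hw1 hcc, hw2 hdd]
    · by_cases hza : z = a
      · subst hza; exact Or.inr ⟨⟨hab, hz1⟩, hz2⟩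
      · exact Or.inl ⟨⟨hza, hz1⟩, hz2⟩
  have haW := hTsub a ac ad
  have hbW := hTsub b bc bd
  have haa : a ∈ ({c, d} : Set X)ᶜ := component_subset haW
  obtain ⟨v, hv1, hv2⟩ := exists_notMem_component h𝒞 hcd' a
  have hVc := compl_diff_component_mem h𝒞 hcd' haa
  have hVd := compl_diff_component_mem' h𝒞 hcd' haa
  have hsub : ∀ W : Set X, W \ component 𝒞 ({c, d} : Set X)ᶜ a ⊆ ({a, b} : Set X)ᶜ := by
    rintro W z hz (rfl | rfl)
    exacts [hz.2 haW, hz.2 hbW]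
  -- For `v` in another component of `{c, d}ᶜ`, the connected set `{c}ᶜ \ W` contains `v` and `d`
  -- and avoids `a` and `b`; so `v` lies with `d`. By symmetry `v` lies with `c`, a contradiction.
  have v1 : v ∈ component 𝒞 ({a, b} : Set X)ᶜ d := subset_component hVc
    ⟨hcd'.symm, fun h => component_subset h (Or.inr rfl)⟩ (hsub _)
    ⟨fun h => hv1 (Or.inl h), hv2⟩
  have v2 : v ∈ component 𝒞 ({a, b} : Set X)ᶜ c := subset_component hVd
    ⟨hcd', fun h => component_subset h (Or.inl rfl)⟩ (hsub _)
    ⟨fun h => hv1 (Or.inr h), hv2⟩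
  exact disjoint_left.1 d1 v2 v1

/-- As there are exactly two components, this set is what remains of `{a}ᶜ` when the other component
is removed, so (C3) applies. -/
theorem insert_component_mem (hab : a ≠ b) (hc : c ∈ ({a, b} : Set X)ᶜ) :
    insert b (component 𝒞 ({a, b} : Set X)ᶜ c) ∈ 𝒞 := by
  obtain ⟨v, hv1, hv2⟩ := exists_notMem_component h𝒞 hab c
  have hne := component_ne_of_notMem h𝒞 hv1 hv2
  have hdisj := disjoint_component h𝒞 hne
  have := compl_diff_component_mem h𝒞 hab hv1
  convert this using 1
  ext z
  constructor
  · rintro (rfl | hz)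
    · exact ⟨hab.symm, fun h => component_subset h (Or.inr rfl)⟩
    · exact ⟨fun h => component_subset hz (Or.inl h), disjoint_left.1 hdisj hz⟩
  · rintro ⟨hza, hz⟩
    by_cases hzb : z = b
    · exact Or.inl hzb
    · have hz' : z ∈ ({a, b} : Set X)ᶜ := by
        rintro (h | h)
        exacts [hza h, hzb h]
      right
      rcases component_eq_or h𝒞 hab hc hv1 hz' with h | h | h
      · exact (hne h).elim
      · rw [h]; exact h𝒞.1.self_mem_component hz'
      · exact (hz (h ▸ h𝒞.1.self_mem_component hz')).elim

theorem insert_component_mem' (hab : a ≠ b) (hc : c ∈ ({a, b} : Set X)ᶜ) :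
    insert a (component 𝒞 ({a, b} : Set X)ᶜ c) ∈ 𝒞 := by
  rw [pair_comm a b] at hc ⊢
  exact insert_component_mem h𝒞 hab.symm hc

theorem insert_insert_component_mem (hab : a ≠ b) (hc : c ∈ ({a, b} : Set X)ᶜ) :
    insert a (insert b (component 𝒞 ({a, b} : Set X)ᶜ c)) ∈ 𝒞 := by
  have := h𝒞.1.unionClosed.union_mem (y := c) (insert_component_mem' h𝒞 hab hc)
    (insert_component_mem h𝒞 hab hc) (Or.inr (h𝒞.1.self_mem_component hc))
    (Or.inr (h𝒞.1.self_mem_component hc))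
  convert this using 1
  ext z
  simp only [mem_insert_iff, mem_union]
  tauto

theorem cross_Phi_iff (hab : a ≠ b) (hac : a ≠ c) (had : a ≠ d) (hbc : b ≠ c) (hbd : b ≠ d) :
    Cross (Phi 𝒞) a b c d ↔ ∀ Z ∈ 𝒞, c ∈ Z → d ∈ Z → a ∈ Z ∨ b ∈ Z :=
  cross_Phi_iff_of_ne h𝒞.1.unionClosed h𝒞.1.singleton_mem hab hac had hbc hbd

/-- If `a` and `b` were in the same component of `{c, d}ᶜ`, the other component together with `c`
and `d` would be a connected set joining `c` to `d` and avoiding `a` and `b`. -/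
theorem cross_Phi_symm (h : Cross (Phi 𝒞) a b c d) : Cross (Phi 𝒞) c d a b := by
  obtain ⟨hab, hac, had, hbc, hbd, hcd, -⟩ := id (cross_Phi.1 h)
  rw [cross_Phi_iff h𝒞 hab hac had hbc hbd] at h
  rw [cross_Phi]
  refine ⟨hcd, hac.symm, hbc.symm, had.symm, hbd.symm, hab, fun heq => ?_⟩
  obtain ⟨v, hv1, hv2⟩ := exists_notMem_component h𝒞 hcd a
  have ha : a ∈ ({c, d} : Set X)ᶜ := by simp [hac, had]
  have hb : b ∈ ({c, d} : Set X)ᶜ := by simp [hbc, hbd]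
  have hdisj := disjoint_component h𝒞 (component_ne_of_notMem h𝒞 hv1 hv2)
  rcases h _ (insert_insert_component_mem h𝒞 hcd hv1) (Or.inl rfl) (Or.inr (Or.inl rfl)) with
    (h | h | h) | (h | h | h)
  · exact hac h
  · exact had h
  · exact disjoint_left.1 hdisj (h𝒞.1.self_mem_component ha) h
  · exact hbc h
  · exact hbd h
  · exact disjoint_left.1 hdisj (heq ▸ h𝒞.1.self_mem_component hb) h

theorem cross_Phi_not_rotate (h : Cross (Phi 𝒞) a b c d) : ¬ Cross (Phi 𝒞) a c b d := by
  obtain ⟨hab, hac, had, hbc, hbd, hcd, hne⟩ := cross_Phi.1 h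
  rw [cross_Phi_iff h𝒞 hac hab had hbc.symm hcd]
  intro hcon
  have hc : c ∈ ({a, b} : Set X)ᶜ := by simp [hac.symm, hbc.symm]
  have hd : d ∈ ({a, b} : Set X)ᶜ := by simp [had.symm, hbd.symm]
  rcases hcon _ (insert_component_mem h𝒞 hab hd) (Or.inl rfl)
    (Or.inr (h𝒞.1.self_mem_component hd)) with (h | h) | (h | h)
  · exact hab h
  · exact component_subset h (Or.inl rfl)
  · exact hbc h.symm
  · exact disjoint_left.1 (disjoint_component h𝒞 hne) (h𝒞.1.self_mem_component hc) h

theorem exists_component_of_not_cross_Phi (hab : a ≠ b) (hac : a ≠ c) (had : a ≠ d) (hbc : b ≠ c)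
    (hbd : b ≠ d) (hcd : c ≠ d) (h : ¬ Cross (Phi 𝒞) a b c d) :
    ∃ v ∈ ({a, b} : Set X)ᶜ, c ∉ component 𝒞 ({a, b} : Set X)ᶜ v ∧
      d ∉ component 𝒞 ({a, b} : Set X)ᶜ v := by
  have heq : component 𝒞 ({a, b} : Set X)ᶜ c = component 𝒞 ({a, b} : Set X)ᶜ d := by
    by_contra hne
    exact h (cross_Phi.2 ⟨hab, hac, had, hbc, hbd, hcd, hne⟩)
  obtain ⟨v, hv1, hv2⟩ := exists_notMem_component h𝒞 hab c
  have hdisj := disjoint_component h𝒞 (component_ne_of_notMem h𝒞 hv1 hv2)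
  have hc : c ∈ ({a, b} : Set X)ᶜ := by simp [hac.symm, hbc.symm]
  have hd : d ∈ ({a, b} : Set X)ᶜ := by simp [had.symm, hbd.symm]
  exact ⟨v, hv1, disjoint_left.1 hdisj (h𝒞.1.self_mem_component hc),
    disjoint_left.1 hdisj (heq ▸ h𝒞.1.self_mem_component hd)⟩

/-- The first component with `b` attached is connected and avoids `a` and `c`. If it met the second
component it would lie inside it, which `b` does not. -/
theorem disjoint_component_of_notMem (hab : a ≠ b) (hac : a ≠ c) (hbc : b ≠ c) {v w : X}
    (hv : v ∈ ({a, b} : Set X)ᶜ) (hc : c ∉ component 𝒞 ({a, b} : Set X)ᶜ v)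
    (hb : b ∉ component 𝒞 ({a, c} : Set X)ᶜ w) :
    Disjoint (component 𝒞 ({a, b} : Set X)ᶜ v) (component 𝒞 ({a, c} : Set X)ᶜ w) := by
  rw [disjoint_left]
  intro z h1 h2
  refine hb (h𝒞.1.unionClosed.subset_component_of_mem (insert_component_mem h𝒞 hab hv)
    (Or.inr h1) h2 ?_ (Or.inl rfl))
  rintro y (rfl | hy) (rfl | rfl)
  · exact hab rfl
  · exact hbc rfl
  · exact component_subset hy (Or.inl rfl)
  · exact hc hy

/-- If no pairing crosses, then for each of the chords `{a, b}`, `{a, c}`, `{a, d}` some component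
of the complement misses the remaining two points. These components, of `v`, `w` and `u`, are
pairwise disjoint. Removing the first two from the circle leaves a connected set containing `a, b,
c, d`, which thus share a component of `{v, w}ᶜ`. Another component, with `v` attached, lies in the
component of `v`; with `w` attached, in that of `w`; but these are disjoint. -/
theorem cross_Phi_total (hab : a ≠ b) (hac : a ≠ c) (had : a ≠ d) (hbc : b ≠ c) (hbd : b ≠ d)
    (hcd : c ≠ d) : Cross (Phi 𝒞) a b c d ∨ Cross (Phi 𝒞) a c b d ∨ Cross (Phi 𝒞) a d b c := by
  by_contra! hcon
  obtain ⟨n1, n2, n3⟩ := hcon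
  have hU := h𝒞.1.unionClosed
  obtain ⟨v, hv, hcv, hdv⟩ := exists_component_of_not_cross_Phi h𝒞 hab hac had hbc hbd hcd n1
  obtain ⟨w, hw, hbw, hdw⟩ := exists_component_of_not_cross_Phi h𝒞 hac hab had hbc.symm hcd hbd n2
  obtain ⟨u, hu, hbu, hcu⟩ :=
    exists_component_of_not_cross_Phi h𝒞 had hab hac hbd.symm hcd.symm hbc n3
  have dvw := disjoint_component_of_notMem h𝒞 hab hac hbc hv hcv hbw
  have dvu := disjoint_component_of_notMem h𝒞 hab had hbd hv hdv hbu
  have dwu := disjoint_component_of_notMem h𝒞 hac had hcd hw hdw hcu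
  have hvv := h𝒞.1.self_mem_component hv
  have hww := h𝒞.1.self_mem_component hw
  have huu := h𝒞.1.self_mem_component hu
  have hvw : v ≠ w := by rintro rfl; exact disjoint_left.1 dvw hvv hww
  have hM := h𝒞.1.diff_mem_of_subset (Y := {a}ᶜ) (x := c) (y := w)
    (compl_diff_component_mem h𝒞 hab hv) sdiff_subset ⟨hac.symm, hcv⟩
    (by rwa [compl_singleton_diff])
    (by
      rw [compl_singleton_diff]
      exact fun z hz => ⟨fun h => component_subset hz (Or.inl h), disjoint_right.1 dvw hz⟩)
  rw [compl_singleton_diff] at hM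
  -- Attaching `a` through the third component restores the point that the complement of `{a}`
  -- lacks.
  have hN := hU.union_mem (y := u) hM (insert_component_mem' h𝒞 had hu)
    ⟨⟨fun h => hu (Or.inl h), disjoint_right.1 dvu huu⟩, disjoint_right.1 dwu huu⟩ (Or.inr huu)
  have hsub : ∀ y, y = a ∨ y = b ∨ y = c ∨ y = d → y ∈ component 𝒞 ({v, w} : Set X)ᶜ a := by
    intro y hy
    refine subset_component hN (Or.inr (Or.inl rfl)) ?_ ?_
    · rintro z (⟨⟨-, h1⟩, h2⟩ | (rfl | h1)) (rfl | rfl)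
      · exact h1 hvv
      · exact h2 hww
      · exact hv (Or.inl rfl)
      · exact hw (Or.inl rfl)
      · exact disjoint_left.1 dvu hvv h1
      · exact disjoint_left.1 dwu hww h1
    · rcases hy with rfl | rfl | rfl | rfl
      · exact Or.inr (Or.inl rfl)
      · exact Or.inl ⟨⟨hab.symm, fun h => component_subset h (Or.inr rfl)⟩, hbw⟩
      · exact Or.inl ⟨⟨hac.symm, hcv⟩, fun h => component_subset h (Or.inr rfl)⟩
      · exact Or.inl ⟨⟨had.symm, hdv⟩, hdw⟩
  obtain ⟨q, hq1, hq2⟩ := exists_notMem_component h𝒞 hvw a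
  have hqd := disjoint_component h𝒞 (component_ne_of_notMem h𝒞 hq1 hq2)
  have hqq := h𝒞.1.self_mem_component hq1
  have mem1 := subset_component (Y := {a, b}ᶜ) (insert_component_mem' h𝒞 hvw hq1) (Or.inl rfl) (by
    rintro z (rfl | hz)
    · exact hv
    · rintro (rfl | rfl)
      · exact disjoint_left.1 hqd (hsub _ (Or.inl rfl)) hz
      · exact disjoint_left.1 hqd (hsub _ (Or.inr (Or.inl rfl))) hz) (Or.inr hqq)
  have mem2 := subset_component (Y := {a, c}ᶜ) (insert_component_mem h𝒞 hvw hq1) (Or.inl rfl) (by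
    rintro z (rfl | hz)
    · exact hw
    · rintro (rfl | rfl)
      · exact disjoint_left.1 hqd (hsub _ (Or.inl rfl)) hz
      · exact disjoint_left.1 hqd (hsub _ (Or.inr (Or.inr (Or.inl rfl)))) hz) (Or.inr hqq)
  exact disjoint_left.1 dvw mem1 mem2

theorem isSeparation_Phi : IsSeparation (Phi 𝒞) where
  symm := by
    have : ∀ k l, Phi 𝒞 k l → Phi 𝒞 l k := by
      rintro ⟨⟨a, b⟩, hk⟩ ⟨⟨c, d⟩, hl⟩ h
      obtain ⟨k', l', h1, h2, h3⟩ := cross_Phi_symm h𝒞 (a := a) (b := b) (c := c) (d := d)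
        ⟨_, _, rfl, rfl, h⟩
      have e1 : k' = ⟨s(c, d), hl⟩ := Subtype.ext h1
      have e2 : l' = ⟨s(a, b), hk⟩ := Subtype.ext h2
      rw [e1, e2] at h3
      exact h3
    exact fun k l => ⟨this k l, this l k⟩
  irrefl a b c _ _ h := (cross_Phi.1 h).2.1 rfl
  total a b c d hab hac had hbc hbd hcd := by
    have h0 := cross_Phi_total h𝒞 hab hac had hbc hbd hcd
    have h1 : Cross (Phi 𝒞) a b c d → ¬ Cross (Phi 𝒞) a c b d := cross_Phi_not_rotate h𝒞
    have h2 : Cross (Phi 𝒞) a b c d → ¬ Cross (Phi 𝒞) a d b c :=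
      fun h => cross_Phi_not_rotate h𝒞 (cross_comm_right.1 h)
    have h3 : Cross (Phi 𝒞) a c b d → ¬ Cross (Phi 𝒞) a d b c :=
      fun h h' => cross_Phi_not_rotate h𝒞 (cross_comm_right.1 h) (cross_comm_right.1 h')
    tauto
  trans a b c d e hab hac had hae hbc hbd hbe hcd hce hde := by
    have hc : c ∈ ({a, b} : Set X)ᶜ := by simp [hac.symm, hbc.symm]
    have hd : d ∈ ({a, b} : Set X)ᶜ := by simp [had.symm, hbd.symm]
    have he : e ∈ ({a, b} : Set X)ᶜ := by simp [hae.symm, hbe.symm]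
    -- With at most two classes among three points, either no pair of the three is separated or
    -- exactly two are.
    have h2 := component_eq_or h𝒞 hab hc hd he
    simp only [cross_Phi, hab, hac, had, hae, hbc, hbd, hbe, hcd, hce, hde, ne_eq,
      not_false_eq_true, true_and]
    generalize component 𝒞 ({a, b} : Set X)ᶜ c = C at *
    generalize component 𝒞 ({a, b} : Set X)ᶜ d = D at *
    generalize component 𝒞 ({a, b} : Set X)ᶜ e = E at *
    by_cases h1 : C = D
    · subst h1; simpa using em _
    · by_cases h3 : C = E
      · subst h3; simp [h1, Ne.symm h1]
      · have h4 := (h2.resolve_left h1).resolve_left h3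
        subst h4; simp [h1]

theorem isDense_Phi : IsDense (Phi 𝒞) := by
  constructor
  · have := h𝒞.2.lt_card
    rw [← ENat.one_lt_card_iff_nontrivial]
    exact lt_of_le_of_lt (by norm_num) this
  · rintro ⟨⟨a, b⟩, hk⟩
    have hab : a ≠ b := by
      intro h; exact hk (Sym2.mk_isDiag_iff.2 h)
    obtain ⟨c, hca, hcb⟩ := exists_ne_ne h𝒞 hab
    have hc : c ∈ ({a, b} : Set X)ᶜ := by simp [hca, hcb]
    obtain ⟨d, hd1, hd2⟩ := exists_notMem_component h𝒞 hab c
    have hcd : c ≠ d := by rintro rfl; exact hd2 (h𝒞.1.self_mem_component hc)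
    exact ⟨⟨s(c, d), by rwa [Sym2.mk_isDiag_iff]⟩, a, b, c, d, rfl, rfl, hab, hca.symm,
      fun h => hd1 (Or.inl h.symm), hcb.symm, fun h => hd1 (Or.inr h.symm), hcd,
      component_ne_of_notMem h𝒞 hd1 hd2⟩

/-- A `2`-flimsy connectivity consists of the arc-convex sets of its separation relation. -/
theorem arcConvex_Phi : arcConvex (Phi 𝒞) = 𝒞 := by
  have hsep := isSeparation_Phi h𝒞
  apply Subset.antisymm
  · intro S hS
    obtain ⟨-, p, -⟩ := (isDense_Phi h𝒞).1.exists_pair_ne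
    obtain rfl | ⟨s, hs⟩ := S.eq_empty_or_nonempty
    · exact h𝒞.1.empty_mem p
    suffices component 𝒞 S s = S from this ▸ h𝒞.1.unionClosed.component_mem
    refine component_subset.antisymm fun t ht => ?_
    by_cases hst : s = t
    · exact hst ▸ h𝒞.1.self_mem_component hs
    -- Two points `s, t` of an arc-convex set are joined inside it by a whole component of `{s,
    -- t}ᶜ`. Otherwise each of the two components contains a point outside `S`, and the chord
    -- through these points separates `s` from `t`.
    have key : ∀ c ∈ ({s, t} : Set X)ᶜ, component 𝒞 ({s, t} : Set X)ᶜ c ⊆ S →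
        t ∈ component 𝒞 S s := fun c hc hcS =>
      subset_component (insert_insert_component_mem h𝒞 hst hc) (Or.inl rfl)
        (insert_subset hs (insert_subset ht hcS)) (Or.inr (Or.inl rfl))
    obtain ⟨c, hcs, hct⟩ := exists_ne_ne h𝒞 hst
    have hc : c ∈ ({s, t} : Set X)ᶜ := by simp [hcs, hct]
    obtain ⟨d, hd1, hd2⟩ := exists_notMem_component h𝒞 hst c
    have hne := component_ne_of_notMem h𝒞 hd1 hd2
    by_contra hcon
    obtain ⟨u, hu, huS⟩ := not_subset.1 fun h => hcon (key c hc h)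
    obtain ⟨v, hv, hvS⟩ := not_subset.1 fun h => hcon (key d hd1 h)
    have hcross : Cross (Phi 𝒞) s t u v := by
      rw [cross_Phi, h𝒞.1.unionClosed.component_eq_of_mem hu,
        h𝒞.1.unionClosed.component_eq_of_mem hv]
      refine ⟨hst, ?_, ?_, ?_, ?_, ?_, hne⟩
      · rintro rfl; exact huS hs
      · rintro rfl; exact hvS hs
      · rintro rfl; exact huS ht
      · rintro rfl; exact hvS ht
      · rintro rfl; exact disjoint_left.1 (disjoint_component h𝒞 hne) hu hv
    rcases hS u v s t (hsep.cross_symm.1 hcross) hs ht with h | h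
    exacts [huS h, hvS h]
  · intro Z hZ a b c d h hc hd
    obtain ⟨hab, hac, had, hbc, hbd, -⟩ := hsep.distinct h
    exact (cross_Phi_iff h𝒞 hab hac had hbc hbd).1 h Z hZ hc hd

end Conn

/-- A bounded non-empty set without supremum splits `{⊥}ᶜ` into a lower part without maximum and an
upper part without minimum. Such a gap violates (C4): no point can be added to both parts, and
intersecting a convex set with either part keeps it convex. -/
theorem hasSups_of_mem_Conn [LinearOrder X] [OrderBot X] [DenselyOrdered X] [NoMaxOrder X]
    (h : arcConvex (sepOf X) ∈ Conn X) : HasSups X := by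
  rintro S ⟨s0, hs0⟩ ⟨u, hu⟩
  by_contra! hcon
  have hmax : ∀ s ∈ S, ∃ t ∈ S, s < t := by
    intro s hs
    by_contra! hle
    exact hcon s ⟨hle, fun w hw => hw hs⟩
  have hub : ∀ w ∈ upperBounds S, ∀ s ∈ S, s < w := by
    intro w hw s hs
    obtain ⟨t, ht, hst⟩ := hmax s hs
    exact hst.trans_le (hw ht)
  have hmin : ∀ w ∈ upperBounds S, ∃ v ∈ upperBounds S, v < w := by
    intro w hw
    by_contra! hle
    exact hcon w ⟨hw, hle⟩
  obtain ⟨s1, hs1, hs01⟩ := hmax s0 hs0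
  set A : Set X := {x | x ≠ ⊥ ∧ ∃ s ∈ S, x ≤ s} with hA
  set B : Set X := upperBounds S with hB
  have hbB : ⊥ ∉ B := fun hb => not_lt_bot (hub _ hb s0 hs0)
  have hAB : ∀ {x y}, x ∈ A → y ∈ B → x < y := by
    rintro x y ⟨-, s, hs, hxs⟩ hy
    exact hxs.trans_lt (hub y hy s hs)
  have hAmax : ∀ x ∈ A, ∃ y ∈ A, x < y := by
    rintro x ⟨hx, s, hs, hxs⟩
    obtain ⟨t, ht, hst⟩ := hmax s hs
    exact ⟨t, ⟨(bot_le.trans_lt hst).ne', t, ht, le_rfl⟩, hxs.trans_lt hst⟩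
  have hAc : A.OrdConnected := ⟨by
    rintro x ⟨hx, -⟩ y ⟨-, s, hs, hys⟩ z ⟨h1, h2⟩
    exact ⟨((bot_lt_iff_ne_bot.2 hx).trans_le h1).ne', s, hs, h2.trans hys⟩⟩
  have hBc : B.OrdConnected := ⟨fun x hx y _ z hz s hs => (hx hs).trans hz.1⟩
  have hAne : s1 ∈ A := ⟨(bot_le.trans_lt hs01).ne', s1, hs1, le_rfl⟩
  have hunion : A ∪ B = {⊥}ᶜ := by
    ext z
    constructor
    · rintro (hz | hz) (rfl : z = ⊥)
      exacts [hz.1 rfl, hbB hz]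
    · intro hz
      by_cases hzs : ∃ s ∈ S, z ≤ s
      · exact Or.inl ⟨hz, hzs⟩
      · push Not at hzs
        exact Or.inr fun s hs => (hzs s hs).le
  have hb : ∀ {T : Set X}, T ⊆ A ∪ B → T ∈ arcConvex (sepOf X) → T.OrdConnected := by
    intro T hT hT'
    refine ordConnected_of_mem_arcConvex hT' fun h => ?_
    have := hT h
    rw [hunion] at this
    exact this rfl
  rcases h.1.button_or_seam A (mem_arcConvex_of_ordConnected hAc) B
    (mem_arcConvex_of_ordConnected hBc) ⟨s1, hAne⟩ ⟨u, hu⟩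
    (hunion ▸ compl_singleton_mem h ⊥) with ⟨x, hx, h1, h2⟩ | ⟨T, hT, hTAB, h1 | h1⟩
  · have h1 := hb (union_subset subset_union_left (singleton_subset_iff.2 hx)) h1
    have h2 := hb (union_subset subset_union_right (singleton_subset_iff.2 hx)) h2
    rcases hx with hx | hx
    · obtain ⟨y, hy, hxy⟩ := hAmax x hx
      rcases h2.out (Or.inr rfl) (Or.inl hu) ⟨hxy.le, (hAB hy hu).le⟩ with h | h
      · exact (hAB hy h).false
      · exact hxy.ne' h
    · obtain ⟨y, hy, hyx⟩ := hmin x hx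
      rcases h1.out (Or.inl hAne) (Or.inr rfl) ⟨(hAB hAne hy).le, hyx.le⟩ with h | h
      · exact (hAB h hy).false
      · exact hyx.ne h
  · exact h1 (mem_arcConvex_of_ordConnected ((hb hTAB hT).inter hAc))
  · exact h1 (mem_arcConvex_of_ordConnected ((hb hTAB hT).inter hBc))

theorem Phi_mem_Sepa {𝒞 : Set (Set X)} (h𝒞 : 𝒞 ∈ Conn X) : Phi 𝒞 ∈ Sepa X := by
  have hsep := isSeparation_Phi h𝒞
  have hd := isDense_Phi h𝒞
  obtain ⟨-, p, -⟩ := hd.1.exists_pair_ne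
  obtain ⟨o, bt, -, hdo, hm, heq⟩ := hsep.exists_linearOrder hd p
  have h2 : arcConvex (sepOf X) ∈ Conn X := by rwa [← heq, arcConvex_Phi h𝒞]
  rw [heq]
  exact sepOf_mem_Sepa (hasSups_of_mem_Conn h2)

/-! ### Order topologies, big circles and their connected sets -/

section Topology

theorem isPreconnected_of_hasSups [LinearOrder X] [TopologicalSpace X] [OrderTopology X]
    [DenselyOrdered X] [OrderBot X] (h : HasSups X) {S : Set X} (hS : S.OrdConnected) :
    IsPreconnected S := by
  classical
  -- The junk value `⊥` is also the value on `∅`, so unbounded sets get the supremum of `∅`, as a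
  -- conditionally complete linear order demands.
  let _ : SupSet X := ⟨fun T => if hT : T.Nonempty ∧ BddAbove T then (h T hT.1 hT.2).choose else ⊥⟩
  let _ : ConditionallyCompleteLinearOrder X :=
    { (inferInstance : LinearOrder X),
      conditionallyCompleteLatticeOfLatticeOfsSup X (fun T hb hn => by
        have e : sSup T = (h T hn hb).choose := dif_pos ⟨hn, hb⟩
        rw [e]
        exact (h T hn hb).choose_spec) with
      csSup_of_not_bddAbove := fun T hT => by
        have e1 : sSup T = ⊥ := dif_neg fun h => hT h.2
        have e2 : sSup (∅ : Set X) = ⊥ := dif_neg fun h : (∅ : Set X).Nonempty ∧ _ =>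
          Set.not_nonempty_empty h.1
        exact e1.trans e2.symm
      csInf_of_not_bddBelow := fun T hT => (hT ⟨⊥, fun _ _ => bot_le⟩).elim }
  exact hS.isPreconnected

theorem hasSups_withTop [LinearOrder X] (h : HasSups X) : HasSups (WithTop X) := by
  rintro S ⟨s, hs⟩ -
  by_cases hb : ∃ u : X, (u : WithTop X) ∈ upperBounds S
  · obtain ⟨u, hu⟩ := hb
    have hcoe : ∀ s ∈ S, ∃ x : X, s = x ∧ x ≤ u := by
      intro s hs
      obtain ⟨x, rfl, hx⟩ := WithTop.le_coe_iff.1 (hu hs)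
      exact ⟨x, rfl, hx⟩
    obtain ⟨x, rfl, -⟩ := hcoe s hs
    obtain ⟨t, ht⟩ := h {x | (x : WithTop X) ∈ S} ⟨x, hs⟩
      ⟨u, fun y hy => WithTop.coe_le_coe.1 (hu hy)⟩
    refine ⟨t, fun y hy => ?_, fun w hw => ?_⟩
    · obtain ⟨y, rfl, -⟩ := hcoe y hy
      exact WithTop.coe_le_coe.2 (ht.1 hy)
    · induction w using WithTop.recTopCoe with
      | top => exact le_top
      | coe w => exact WithTop.coe_le_coe.2 (ht.2 fun y hy => WithTop.coe_le_coe.1 (hw hy))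
  · push Not at hb
    refine ⟨⊤, fun _ _ => le_top, fun w hw => ?_⟩
    induction w using WithTop.recTopCoe with
    | top => exact le_rfl
    | coe w => exact (hb w hw).elim

variable [LinearOrder X] [OrderBot X]

/-- The map identifying the two ends of the closed interval `WithTop X`. -/
def closeUp (X : Type u) [LinearOrder X] [OrderBot X] : WithTop X → X := WithTop.untopD ⊥

@[simp] theorem closeUp_coe (x : X) : closeUp X x = x := rfl

@[simp] theorem closeUp_top : closeUp X ⊤ = ⊥ := rfl

theorem closeUp_preimage_Ioo (x y : X) : closeUp X ⁻¹' Ioo x y = Ioo (x : WithTop X) y := by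
  ext l
  induction l using WithTop.recTopCoe with
  | top => simp
  | coe l => simp

theorem closeUp_preimage_Icc_compl_of_bot_lt {x y : X} (hx : ⊥ < x) :
    closeUp X ⁻¹' (Icc x y)ᶜ = (Icc (x : WithTop X) y)ᶜ := by
  ext l
  induction l using WithTop.recTopCoe with
  | top => simp [hx.ne']
  | coe l => simp

theorem closeUp_preimage_Icc_bot_compl (y : X) :
    closeUp X ⁻¹' (Icc ⊥ y)ᶜ = Ioo (y : WithTop X) ⊤ := by
  ext l
  induction l using WithTop.recTopCoe with
  | top => simp
  | coe l => simp

variable [DenselyOrdered X] [NoMaxOrder X]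

/-- The quotient and order topologies need comparison chiefly at the glued point. There an open set
contains an initial and a final segment of `WithTop X`, hence the image of the complement of a
closed interval. -/
theorem coinduced_closeUp [TopologicalSpace (WithTop X)] [OrderTopology (WithTop X)] :
    TopologicalSpace.coinduced (closeUp X) inferInstance = Psi (sepOf X) := by
  apply le_antisymm
  · rw [TopologicalSpace.le_generateFrom_iff_subset_isOpen]
    intro I hI
    obtain ⟨x, y, hxy, rfl | rfl⟩ := isOpenInterval_sepOf.1 hI
    · change IsOpen (closeUp X ⁻¹' _)
      rw [closeUp_preimage_Ioo]
      exact isOpen_Ioo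
    · change IsOpen (closeUp X ⁻¹' _)
      rcases eq_or_lt_of_le (bot_le (a := x)) with rfl | hx
      · rw [closeUp_preimage_Icc_bot_compl]
        exact isOpen_Ioo
      · rw [closeUp_preimage_Icc_compl_of_bot_lt hx]
        exact isClosed_Icc.isOpen_compl
  · intro U hU
    have hV : IsOpen (closeUp X ⁻¹' U) := hU
    refine (@isOpen_iff_forall_mem_open X (Psi (sepOf X)) U).2 fun q hq => ?_
    have open_of : ∀ I, IsOpenInterval (sepOf X) I → @IsOpen X (Psi (sepOf X)) I :=
      fun I hI => TopologicalSpace.isOpen_generateFrom_of_mem hI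
    have hqV : (q : WithTop X) ∈ closeUp X ⁻¹' U := hq
    rcases eq_or_lt_of_le (bot_le (a := q)) with rfl | hq0
    · have hTV : (⊤ : WithTop X) ∈ closeUp X ⁻¹' U := hq
      obtain ⟨u, hu, hsu⟩ := exists_Ico_subset_of_mem_nhds (hV.mem_nhds hqV)
        ⟨⊤, WithTop.coe_lt_top _⟩
      obtain ⟨l, hl, hsl⟩ := exists_Ioc_subset_of_mem_nhds (hV.mem_nhds hTV)
        ⟨((⊥ : X) : WithTop X), WithTop.coe_lt_top _⟩
      obtain ⟨x, hx1, hx2⟩ := exists_between hu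
      lift x to X using (hx2.trans_le le_top).ne
      lift l to X using hl.ne
      rw [WithTop.coe_lt_coe] at hx1
      -- Beyond `l`, so that the points after `y` stay in the final segment; beyond `x`, so that
      -- `Icc x y` is nondegenerate.
      obtain ⟨y, hy⟩ := exists_gt (max l x)
      refine ⟨(Icc x y)ᶜ, ?_, open_of _ (isOpenInterval_sepOf.2
        ⟨x, y, (le_max_right _ _).trans_lt hy, Or.inr rfl⟩), fun h => hx1.not_ge h.1⟩
      intro z hz
      rcases lt_or_ge z x with h1 | h1
      · exact hsu (a := (z : WithTop X))
          ⟨WithTop.coe_le_coe.2 bot_le, (WithTop.coe_lt_coe.2 h1).trans hx2⟩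
      · have h2 : y < z := lt_of_not_ge fun h => hz ⟨h1, h⟩
        exact hsl (a := (z : WithTop X))
          ⟨WithTop.coe_lt_coe.2 (((le_max_left _ _).trans_lt hy).trans h2), le_top⟩
    · obtain ⟨l, u, ⟨hl, hu⟩, hs⟩ := (mem_nhds_iff_exists_Ioo_subset'
        ⟨((⊥ : X) : WithTop X), WithTop.coe_lt_coe.2 hq0⟩ ⟨⊤, WithTop.coe_lt_top q⟩).1
        (hV.mem_nhds hqV)
      lift l to X using (hl.trans (WithTop.coe_lt_top q)).ne
      obtain ⟨y, hy1, hy2⟩ := exists_between hu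
      lift y to X using (hy2.trans_le le_top).ne
      rw [WithTop.coe_lt_coe] at hl hy1
      refine ⟨Ioo l y, fun z hz => ?_, open_of _ (isOpenInterval_sepOf.2
        ⟨l, y, hl.trans hy1, Or.inl rfl⟩), hl, hy1⟩
      exact hs (a := (z : WithTop X))
        ⟨WithTop.coe_lt_coe.2 hz.1, (WithTop.coe_lt_coe.2 hz.2).trans hy2⟩

theorem isBigInterval_withTop (h : HasSups X) [TopologicalSpace (WithTop X)]
    [OrderTopology (WithTop X)] : IsBigInterval (WithTop X) where
  orderTopology := inferInstance
  nontrivial := ⟨((⊥ : X) : WithTop X), ⊤, WithTop.coe_ne_top⟩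
  dense _ _ hxy := exists_between hxy
  complete := hasSups_withTop h
  exists_min := ⟨⊥, isBot_bot⟩
  exists_max := ⟨⊤, isTop_top⟩

theorem isBigCircle_Psi_sepOf (h : HasSups X) : IsBigCircle (Psi (sepOf X)) := by
  let _ : TopologicalSpace (WithTop X) := Preorder.topology _
  have : OrderTopology (WithTop X) := ⟨rfl⟩
  refine ⟨WithTop X, inferInstance, inferInstance, isBigInterval_withTop h, ?_⟩
  rw [← coinduced_closeUp]
  let _ : TopologicalSpace X := TopologicalSpace.coinduced (closeUp X) inferInstance
  have hc : ∀ l m : WithTop X, EndsRel (WithTop X) l m → closeUp X l = closeUp X m := by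
    rintro l m ⟨hl, hm⟩
    rw [isBot_iff_eq_bot.1 hl, isTop_iff_eq_top.1 hm]
    rfl
  have hends : (Quot.mk (EndsRel (WithTop X)) ((⊥ : X) : WithTop X)) = Quot.mk _ ⊤ :=
    Quot.sound ⟨fun l => bot_le (α := WithTop X), isTop_top⟩
  refine ⟨{ toFun := Quot.lift (closeUp X) hc
            invFun := fun x => Quot.mk _ (x : WithTop X)
            left_inv := ?_
            right_inv := fun x => rfl
            continuous_toFun := continuous_quot_lift hc continuous_coinduced_rng
            continuous_invFun := ?_ }⟩
  · rintro ⟨l⟩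
    induction l using WithTop.recTopCoe with
    | top => exact hends
    | coe l => rfl
  · refine continuous_coinduced_dom.2 ?_
    convert continuous_quot_mk (r := EndsRel (WithTop X)) using 1
    ext l
    induction l using WithTop.recTopCoe with
    | top => exact hends
    | coe l => rfl

end Topology

theorem Psi_mem_BCir {R : ChordRel X} (hR : R ∈ Sepa X) : Psi R ∈ BCir X := by
  obtain ⟨p, -⟩ := hR.2.1.1.exists_pair_ne
  obtain ⟨o, bt, -, hd, hm, hs, rfl⟩ := exists_linearOrder_of_mem_Sepa hR p
  exact isBigCircle_Psi_sepOf hs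

/-- A separating chord disjoint from `S` disconnects `S` by its two open sides. Conversely, cut at a
point `p` of an arc-convex `S`: for each `t ∈ S` one of the two arcs from `p` to `t` lies in `S`,
since otherwise a missing point on each arc gives a chord separating `p` from `t`. The arcs are
continuous images of closed intervals. -/
theorem Upsilon_Psi {R : ChordRel X} (hR : R ∈ Sepa X) : Upsilon (Psi R) = arcConvex R := by
  apply Subset.antisymm
  · intro S hS a b c d h hc hd
    by_contra! hab
    let _ := Psi R
    obtain ⟨h1, h2, h3, h4, h5, h6⟩ := hR.1.distinct h
    have hU : IsOpen (intervalAvoiding R a b c) :=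
      TopologicalSpace.isOpen_generateFrom_of_mem ⟨a, b, c, h1, h2, h4, Or.inl rfl⟩
    have hV : IsOpen (intervalContaining R a b c) :=
      TopologicalSpace.isOpen_generateFrom_of_mem ⟨a, b, c, h1, h2, h4, Or.inr rfl⟩
    have hSab : S ⊆ ({a, b} : Set X)ᶜ := by
      rintro z hz (rfl | rfl)
      exacts [hab.1 hz, hab.2 hz]
    obtain ⟨z, -, hz1, hz2⟩ := hS _ _ hU hV
      (fun z hz => (em (z ∈ intervalAvoiding R a b c)).imp id fun h => ⟨hSab hz, h⟩)
      ⟨d, hd, by simp [h3.symm, h5.symm, h6.symm], h⟩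
      ⟨c, hc, hSab hc, fun h => h.1 (by simp)⟩
    exact hz2.2 hz1
  · intro S hS
    obtain rfl | ⟨p, hp⟩ := S.eq_empty_or_nonempty
    · exact @isPreconnected_empty X (Psi R)
    obtain ⟨o, bt, rfl, hd, hm, hs, rfl⟩ := exists_linearOrder_of_mem_Sepa hR p
    let _ : TopologicalSpace (WithTop X) := Preorder.topology _
    have : OrderTopology (WithTop X) := ⟨rfl⟩
    let _ := Psi (sepOf X)
    have hcont : Continuous (closeUp X) :=
      continuous_iff_coinduced_le.2 coinduced_closeUp.le
    have hpre : ∀ l m : WithTop X, IsPreconnected (closeUp X '' Icc l m) := fun l m =>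
      (isPreconnected_of_hasSups (hasSups_withTop hs) ordConnected_Icc).image _ hcont.continuousOn
    refine isPreconnected_of_forall ⊥ fun t ht => ?_
    by_cases h1 : Icc ⊥ t ⊆ S
    · refine ⟨closeUp X '' Icc ((⊥ : X) : WithTop X) t, ?_,
        ⟨_, ⟨le_rfl, WithTop.coe_le_coe.2 bot_le⟩, rfl⟩,
        ⟨_, ⟨WithTop.coe_le_coe.2 bot_le, le_rfl⟩, rfl⟩, hpre _ _⟩
      rintro _ ⟨l, ⟨-, hl⟩, rfl⟩
      obtain ⟨x, rfl, hx⟩ := WithTop.le_coe_iff.1 hl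
      exact h1 ⟨bot_le, hx⟩
    · obtain ⟨u, hu, huS⟩ := not_subset.1 h1
      refine ⟨closeUp X '' Icc (t : WithTop X) ⊤, ?_, ⟨⊤, ⟨le_top, le_rfl⟩, rfl⟩,
        ⟨_, ⟨le_rfl, le_top⟩, rfl⟩, hpre _ _⟩
      rintro _ ⟨l, ⟨hl, -⟩, rfl⟩
      induction l using WithTop.recTopCoe with
      | top => exact hp
      | coe v =>
        rw [WithTop.coe_le_coe] at hl
        change v ∈ S
        by_contra hvS
        have hbu : ⊥ < u := bot_lt_iff_ne_bot.2 (by rintro rfl; exact huS hp)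
        have hut : u < t := hu.2.lt_of_ne (by rintro rfl; exact huS ht)
        have htv : t < v := hl.lt_of_ne (by rintro rfl; exact hvS ht)
        have := ((interlaced_of_lt (hbu.trans hut)).2
          (Or.inl ⟨⟨hbu, hut⟩, fun h => h.2.not_gt htv⟩)).symm
        rcases hS _ _ _ _ (cross_sepOf.2 this) hp ht with h | h
        exacts [huS h, hvS h]

/-- The points of the circle correspond to `L` without its maximum. Ordering `X` accordingly
identifies `L` with `WithTop X` and the quotient map with `closeUp X`, so that `coinduced_closeUp`
applies. -/
theorem exists_eq_Psi_of_mem_BCir {τ : TopologicalSpace X} (hτ : τ ∈ BCir X) :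
    ∃ R ∈ Sepa X, τ = Psi R := by
  classical
  obtain ⟨L, oL, tL, hL, ⟨h⟩⟩ := hτ
  obtain ⟨m, hm⟩ := hL.exists_min
  obtain ⟨M, hM⟩ := hL.exists_max
  have := hL.orderTopology
  have hmM : m < M := by
    obtain ⟨a, b, hab⟩ := hL.nontrivial.exists_pair_ne
    refine (hm M).lt_of_ne fun heq => hab ?_
    exact ((hM a).trans (heq ▸ hm b)).antisymm ((hM b).trans (heq ▸ hm a))
  -- Canonical representative in the quotient: the glued point is represented by the minimum `m`.
  let ρ : L → {l : L // l ≠ M} := fun l => if hl : l = M then ⟨m, hmM.ne⟩ else ⟨l, hl⟩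
  have ρM : ρ M = ⟨m, hmM.ne⟩ := dif_pos rfl
  have ρne : ∀ l (hl : l ≠ M), ρ l = ⟨l, hl⟩ := fun l hl => dif_neg hl
  have hρ : ∀ l l', EndsRel L l l' → ρ l = ρ l' := by
    rintro l l' ⟨h1, h2⟩
    rw [(hM l').antisymm (h2 M), (h1 m).antisymm (hm l), ρM, ρne m hmM.ne]
  let e : X ≃ {l : L // l ≠ M} :=
    { toFun := fun x => Quot.lift ρ hρ (h.symm x)
      invFun := fun l => h (Quot.mk _ l.1)
      left_inv := by
        intro x
        obtain ⟨q, rfl⟩ := h.surjective x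
        simp only [Homeomorph.symm_apply_apply]
        congr 1
        obtain ⟨l⟩ := q
        change Quot.mk _ (ρ l).1 = Quot.mk _ l
        by_cases hl : l = M
        · rw [hl, ρM]
          exact Quot.sound ⟨hm, hM⟩
        · rw [ρne l hl]
      right_inv := by
        rintro ⟨l, hl⟩
        simp only [Homeomorph.symm_apply_apply]
        exact ρne l hl }
  let oX : LinearOrder X := LinearOrder.lift' e e.injective
  have ltM : ∀ x, (e x : L) < M := fun x => (hM _).lt_of_ne (e x).2
  have le_iff : ∀ x y : X, x ≤ y ↔ (e x : L) ≤ e y := fun x y => Iff.rfl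
  have lt_iff : ∀ x y : X, x < y ↔ (e x : L) < e y := fun x y => Iff.rfl
  have surj : ∀ l, l < M → ∃ x, (e x : L) = l := fun l hl =>
    ⟨e.symm ⟨l, hl.ne⟩, by rw [Equiv.apply_symm_apply]⟩
  let bX : OrderBot X :=
    { bot := e.symm ⟨m, hmM.ne⟩
      bot_le := fun x => by
        rw [le_iff, Equiv.apply_symm_apply]
        exact hm _ }
  have hbot : (e ⊥ : L) = m := by
    change (e (e.symm ⟨m, hmM.ne⟩) : L) = m
    rw [Equiv.apply_symm_apply]
  have : DenselyOrdered X := ⟨fun x y hxy => by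
    obtain ⟨l, h1, h2⟩ := hL.dense _ _ ((lt_iff x y).1 hxy)
    obtain ⟨z, rfl⟩ := surj l (h2.trans (ltM y))
    exact ⟨z, h1, h2⟩⟩
  have : NoMaxOrder X := ⟨fun x => by
    obtain ⟨l, h1, h2⟩ := hL.dense _ _ (ltM x)
    obtain ⟨z, rfl⟩ := surj l h2
    exact ⟨z, h1⟩⟩
  have hsups : HasSups X := by
    rintro T ⟨t, ht⟩ ⟨u, hu⟩
    have hbd : (e u : L) ∈ upperBounds ((fun x => (e x : L)) '' T) := by
      rintro _ ⟨x, hx, rfl⟩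
      exact hu hx
    obtain ⟨s, hs⟩ := hL.complete ((fun x => (e x : L)) '' T) ⟨_, t, ht, rfl⟩ ⟨_, hbd⟩
    obtain ⟨z, rfl⟩ := surj s ((hs.2 hbd).trans_lt (ltM u))
    refine ⟨z, fun x hx => hs.1 ⟨x, hx, rfl⟩, fun w hw => hs.2 ?_⟩
    rintro _ ⟨x, hx, rfl⟩
    exact hw hx
  refine ⟨sepOf X, sepOf_mem_Sepa hsups, ?_⟩
  let _ : TopologicalSpace (WithTop X) := Preorder.topology _
  have : OrderTopology (WithTop X) := ⟨rfl⟩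
  let ψ : WithTop X → L := WithTop.recTopCoe M fun x => (e x : L)
  have ψmono : StrictMono ψ := by
    intro a b hab
    induction a using WithTop.recTopCoe with
    | top => exact (not_top_lt hab).elim
    | coe a =>
      induction b using WithTop.recTopCoe with
      | top => exact ltM a
      | coe b => exact (lt_iff a b).1 (WithTop.coe_lt_coe.1 hab)
  have ψsurj : Function.Surjective ψ := by
    intro l
    rcases (hM l).eq_or_lt with rfl | hl
    · exact ⟨⊤, rfl⟩
    · obtain ⟨x, rfl⟩ := surj l hl
      exact ⟨x, rfl⟩
  let Ψ := (ψmono.orderIsoOfSurjective ψ ψsurj).toHomeomorph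
  have hcomp : closeUp X = (h ∘ Quot.mk (EndsRel L)) ∘ Ψ := by
    ext l
    induction l using WithTop.recTopCoe with
    | top =>
      change (⊥ : X) = h (Quot.mk _ M)
      have : Quot.mk (EndsRel L) m = Quot.mk _ M := Quot.sound ⟨hm, hM⟩
      rw [← this, ← hbot]
      exact (e.symm_apply_apply ⊥).symm
    | coe l => exact (e.symm_apply_apply l).symm
  rw [← coinduced_closeUp, hcomp, ← coinduced_compose, Ψ.coinduced_eq, ← coinduced_compose]
  exact h.coinduced_eq.symm

end CircleLike

theorem mainTheorem9 (X : Type*) :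
    -- the three maps are well defined
    (MapsTo CircleLike.Upsilon (CircleLike.BCir X) (CircleLike.Conn X) ∧
      MapsTo CircleLike.Phi (CircleLike.Conn X) (CircleLike.Sepa X) ∧
      MapsTo CircleLike.Psi (CircleLike.Sepa X) (CircleLike.BCir X)) ∧
    -- every loop around the triangle is the identity
    (∀ τ ∈ CircleLike.BCir X,
      CircleLike.Psi (CircleLike.Phi (CircleLike.Upsilon τ)) = τ) ∧
    (∀ 𝒞 ∈ CircleLike.Conn X,
      CircleLike.Upsilon (CircleLike.Psi (CircleLike.Phi 𝒞)) = 𝒞) ∧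
    (∀ R ∈ CircleLike.Sepa X,
      CircleLike.Phi (CircleLike.Upsilon (CircleLike.Psi R)) = R) ∧
    -- hence the three maps are bijections
    (BijOn CircleLike.Upsilon (CircleLike.BCir X) (CircleLike.Conn X) ∧
      BijOn CircleLike.Phi (CircleLike.Conn X) (CircleLike.Sepa X) ∧
      BijOn CircleLike.Psi (CircleLike.Sepa X) (CircleLike.BCir X)) := by
  have hΥ : MapsTo CircleLike.Upsilon (CircleLike.BCir X) (CircleLike.Conn X) := by
    intro τ hτ
    obtain ⟨R, hR, rfl⟩ := CircleLike.exists_eq_Psi_of_mem_BCir hτ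
    rw [CircleLike.Upsilon_Psi hR]
    exact CircleLike.arcConvex_mem_Conn hR
  have hΦ : MapsTo CircleLike.Phi (CircleLike.Conn X) (CircleLike.Sepa X) :=
    fun _ h => CircleLike.Phi_mem_Sepa h
  have hΨ : MapsTo CircleLike.Psi (CircleLike.Sepa X) (CircleLike.BCir X) :=
    fun _ h => CircleLike.Psi_mem_BCir h
  have h3 : ∀ R ∈ CircleLike.Sepa X,
      CircleLike.Phi (CircleLike.Upsilon (CircleLike.Psi R)) = R := by
    intro R hR
    rw [CircleLike.Upsilon_Psi hR, CircleLike.Phi_arcConvex hR]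
  have h2 : ∀ 𝒞 ∈ CircleLike.Conn X,
      CircleLike.Upsilon (CircleLike.Psi (CircleLike.Phi 𝒞)) = 𝒞 := by
    intro 𝒞 h
    rw [CircleLike.Upsilon_Psi (hΦ h), CircleLike.arcConvex_Phi h]
  have h1 : ∀ τ ∈ CircleLike.BCir X,
      CircleLike.Psi (CircleLike.Phi (CircleLike.Upsilon τ)) = τ := by
    intro τ hτ
    obtain ⟨R, hR, rfl⟩ := CircleLike.exists_eq_Psi_of_mem_BCir hτ
    rw [h3 R hR]
  refine ⟨⟨hΥ, hΦ, hΨ⟩, h1, h2, h3, ⟨hΥ, ?_, ?_⟩, ⟨hΦ, ?_, ?_⟩, ⟨hΨ, ?_, ?_⟩⟩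
  · intro τ hτ τ' hτ' h
    rw [← h1 τ hτ, h, h1 τ' hτ']
  · exact fun 𝒞 h => ⟨_, hΨ (hΦ h), h2 𝒞 h⟩
  · intro 𝒞 h 𝒞' h' heq
    rw [← h2 𝒞 h, heq, h2 𝒞' h']
  · exact fun R hR => ⟨_, hΥ (hΨ hR), h3 R hR⟩
  · intro R hR R' hR' h
    rw [← h3 R hR, h, h3 R' hR']
  · exact fun τ hτ => ⟨_, hΦ (hΥ hτ), h1 τ hτ⟩
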